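/- For $N\ge 0$ let $V_N$ be the complex vector space of $1$-forms $\omega=a\,dX+b\,dY+c\,dZ$ on $\mathbb{C}^3$ whose coefficients $a,b,c\in\mathbb{C}[X,Y,Z]$ are homogeneous of degree $N+1$ and satisfy $aX+bY+cZ=0$. The set $\mathscr{F}(2;N)$ of foliations of degree $N$ on $\mathbb{P}^2(\mathbb{C})$ is the subset of $\mathbb{P}(V_N)$ of the classes $[\omega]$ such that $a,b,c$ have no nonconstant common factor. The group $\mathrm{Aut}(\mathbb{P}^2(\mathbb{C}))=\mathrm{PGL}_3(\mathbb{C})$ acts on $\mathbb{P}(V_N)$ by $\varphi\cdot[\omega]=[(\varphi^{-1})^*\omega]$, and $\mathscr{F}(2;N)$ is stable under this action. For $\mathcal{F}\in\mathscr{F}(2;N)$, let $\mathcal{O}(\mathcal{F})\subset\mathbb{P}(V_N)$ be its orbit and $\mathrm{Iso}(\mathcal{F})\subset\mathrm{PGL}_3(\mathbb{C})$ its stabilizer. Dimensions are those of algebraic geometry, that is, Krull dimensions for the Zariski topology, where $\mathrm{PGL}_3(\mathbb{C})$ is regarded as the open subset of classes of invertible matrices in $\mathbb{P}(M_3(\mathbb{C}))=\mathbb{P}^8(\mathbb{C})$.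 (1) For every integer $N\ge 2$ and every $\mathcal{F}\in\mathscr{F}(2;N)$, $$\dim\mathcal{O}(\mathcal{F})\ge 6\qquad\text{and}\qquad \dim\mathrm{Iso}(\mathcal{F})\le 2 .$$ (2) Let $\mathcal{F}_1$ be the foliation of degree $2$ defined in the affine chart $Z=1$ by $\omega_1=x^2\,dx+y^2(x\,dy-y\,dx)$, that is, by the homogeneous form $(X^2Z-Y^3)\,dX+XY^2\,dY-X^3\,dZ$. Then $\mathcal{F}_1\in\mathscr{F}(2;2)$, $\dim\mathcal{O}(\mathcal{F}_1)=6$, and $\dim\mathcal{O}(\mathcal{F}_1)\le\dim\mathcal{O}(\mathcal{F})$ for every $\mathcal{F}\in\mathscr{F}(2;2)$. -/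

import Mathlib

open scoped LinearAlgebra.Projectivization MatrixGroups

noncomputable section

namespace PlaneFoliation

open MvPolynomial

/-! ### Dimension of subsets of a projective space -/

/-- The Zariski topology on the projective space of lines of a complex vector space `V`: the
nonvanishing loci of the homogeneous polynomials in the linear coordinates on `V` form a basis of
open sets. -/
@[reducible]
def zariskiTopology (V : Type*) [AddCommGroup V] [Module ℂ V] : TopologicalSpace (ℙ ℂ V) :=
  TopologicalSpace.generateFrom
    {U | ∃ (d : ℕ) (p : MvPolynomial (Module.Dual ℂ V) ℂ), p.IsHomogeneous d ∧
      U = {x | eval (fun l : Module.Dual ℂ V => l x.rep) p ≠ 0}}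

/-- The dimension of a subset of a projective space: the Krull dimension of the topology induced
by the Zariski topology. -/
def zariskiDim {V : Type*} [AddCommGroup V] [Module ℂ V] (S : Set (ℙ ℂ V)) : WithBot ℕ∞ :=
  @topologicalKrullDim S (TopologicalSpace.induced Subtype.val (zariskiTopology V))

/-! ### Polynomial one-forms and their pull-back by linear maps -/

/-- The triple `ω` stands for the one-form `ω 0 dX₀ + ω 1 dX₁ + ω 2 dX₂` on `ℂ³`. -/
abbrev OneForm : Type := Fin 3 → MvPolynomial (Fin 3) ℂ

/-- The substitution `p(x) ↦ p(M x)`. -/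
def substLin (M : Matrix (Fin 3) (Fin 3) ℂ) :
    MvPolynomial (Fin 3) ℂ →ₐ[ℂ] MvPolynomial (Fin 3) ℂ :=
  aeval fun k => ∑ l, C (M k l) * X l

/-- The pull-back of a one-form by the linear map `x ↦ M x`, that is
`∑ i, ω i (M x) d((M x)ᵢ)`. -/
def pullback (M : Matrix (Fin 3) (Fin 3) ℂ) : OneForm →ₗ[ℂ] OneForm where
  toFun ω := fun j => ∑ i, C (M i j) * substLin M (ω i)
  map_add' ω η := by
    funext j
    simp [mul_add, Finset.sum_add_distrib]
  map_smul' c ω := by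
    funext j
    simp [Finset.smul_sum]

lemma pullback_apply (M : Matrix (Fin 3) (Fin 3) ℂ) (ω : OneForm) (j : Fin 3) :
    pullback M ω j = ∑ i, C (M i j) * substLin M (ω i) := rfl

lemma substLin_X (M : Matrix (Fin 3) (Fin 3) ℂ) (k : Fin 3) :
    substLin M (X k) = ∑ l, C (M k l) * X l := by
  simp [substLin]

lemma substLin_C (M : Matrix (Fin 3) (Fin 3) ℂ) (c : ℂ) : substLin M (C c) = C c := by
  simp [substLin]

lemma substLin_one (p : MvPolynomial (Fin 3) ℂ) : substLin 1 p = p := by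
  have h : substLin 1 = AlgHom.id ℂ _ := by
    apply MvPolynomial.algHom_ext
    intro k
    rw [substLin_X]
    simp [Matrix.one_apply]
  rw [h, AlgHom.id_apply]

lemma substLin_mul (M N : Matrix (Fin 3) (Fin 3) ℂ) (p : MvPolynomial (Fin 3) ℂ) :
    substLin (M * N) p = substLin N (substLin M p) := by
  have h : substLin (M * N) = (substLin N).comp (substLin M) := by
    apply MvPolynomial.algHom_ext
    intro k
    simp only [AlgHom.comp_apply, substLin_X, map_sum, map_mul, substLin_C, Matrix.mul_apply,
      Finset.sum_mul, Finset.mul_sum, mul_assoc]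
    exact Finset.sum_comm
  rw [h, AlgHom.comp_apply]

lemma pullback_one (ω : OneForm) : pullback 1 ω = ω := by
  funext j
  simp [pullback_apply, substLin_one, Matrix.one_apply]

lemma pullback_mul (M N : Matrix (Fin 3) (Fin 3) ℂ) (ω : OneForm) :
    pullback (M * N) ω = pullback N (pullback M ω) := by
  funext j
  simp only [pullback_apply, substLin_mul, map_sum, map_mul, substLin_C, Matrix.mul_apply,
    Finset.sum_mul, Finset.mul_sum]
  rw [Finset.sum_comm]
  refine Finset.sum_congr rfl fun i _ => Finset.sum_congr rfl fun k _ => ?_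
  ring

lemma substLin_isHomogeneous (M : Matrix (Fin 3) (Fin 3) ℂ) {p : MvPolynomial (Fin 3) ℂ} {n : ℕ}
    (hp : p.IsHomogeneous n) : (substLin M p).IsHomogeneous n := by
  have h := hp.aeval (fun k => ∑ l, C (M k l) * X l : Fin 3 → MvPolynomial (Fin 3) ℂ) (n := 1)
    fun k => IsHomogeneous.sum _ _ _ fun l _ => (isHomogeneous_X ℂ l).C_mul _
  simpa [substLin] using h

/-! ### Foliations -/

/-- The space of one-forms `ω = ω 0 dX₀ + ω 1 dX₁ + ω 2 dX₂` whose coefficients are homogeneous of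
degree `N + 1` and satisfy the Euler identity `X₀ ω 0 + X₁ ω 1 + X₂ ω 2 = 0`. -/
def eulerForms (N : ℕ) : Submodule ℂ OneForm where
  carrier := {ω | (∀ i, (ω i).IsHomogeneous (N + 1)) ∧ ∑ i, X i * ω i = 0}
  add_mem' {ω η} hω hη := by
    refine ⟨fun i => (hω.1 i).add (hη.1 i), ?_⟩
    simp [mul_add, Finset.sum_add_distrib, hω.2, hη.2]
  zero_mem' := by
    refine ⟨fun i => isHomogeneous_zero _ _ _, ?_⟩
    simp
  smul_mem' c ω hω := by
    refine ⟨fun i => ?_, ?_⟩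
    · simpa [MvPolynomial.smul_eq_C_mul] using (hω.1 i).C_mul c
    · have := congrArg (c • ·) hω.2
      simpa [Finset.smul_sum] using this

lemma pullback_mem {N : ℕ} (M : Matrix (Fin 3) (Fin 3) ℂ) {ω : OneForm} (hω : ω ∈ eulerForms N) :
    pullback M ω ∈ eulerForms N := by
  refine ⟨fun j => IsHomogeneous.sum _ _ _ fun i _ =>
    (substLin_isHomogeneous M (hω.1 i)).C_mul _, ?_⟩
  have h := congrArg (substLin M) hω.2
  simp only [map_sum, map_mul, substLin_X, map_zero] at h
  rw [← h]
  simp only [pullback_apply, Finset.mul_sum, Finset.sum_mul]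
  rw [Finset.sum_comm]
  refine Finset.sum_congr rfl fun i _ => Finset.sum_congr rfl fun j _ => ?_
  ring

/-- The set `𝓕(2; N)` of foliations of degree `N` on `ℙ²(ℂ)`: classes, modulo nonzero scalars, of
homogeneous one-forms of degree `N + 1` which satisfy the Euler identity and whose coefficients
have no common factor. -/
def foliations (N : ℕ) : Set (ℙ ℂ (eulerForms N)) :=
  {F | ∀ d : MvPolynomial (Fin 3) ℂ, (∀ i, d ∣ (F.rep : OneForm) i) → IsUnit d}

/-! ### The action of `PGL₃(ℂ)` -/

/-- A linear automorphism `g` transports a one-form `ω` to `(g⁻¹)^* ω`. -/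
instance glAction (N : ℕ) : DistribMulAction (GL (Fin 3) ℂ) (eulerForms N) where
  smul g ω := ⟨pullback (g⁻¹ : GL (Fin 3) ℂ).val ω.1, pullback_mem _ ω.2⟩
  one_smul ω := Subtype.ext <| by
    change pullback (1⁻¹ : GL (Fin 3) ℂ).val ω.1 = ω.1
    rw [inv_one, Units.val_one, pullback_one]
  mul_smul g h ω := Subtype.ext <| by
    change pullback ((g * h)⁻¹ : GL (Fin 3) ℂ).val ω.1 =
      pullback (g⁻¹ : GL (Fin 3) ℂ).val (pullback (h⁻¹ : GL (Fin 3) ℂ).val ω.1)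
    rw [mul_inv_rev, Units.val_mul, pullback_mul]
  smul_zero _ := Subtype.ext (map_zero (pullback _))
  smul_add _ _ _ := Subtype.ext (map_add (pullback _) _ _)

lemma gl_smul_val {N : ℕ} (g : GL (Fin 3) ℂ) (ω : eulerForms N) :
    (g • ω).1 = pullback (g⁻¹ : GL (Fin 3) ℂ).val ω.1 := rfl

instance glAction_comm (N : ℕ) : SMulCommClass (GL (Fin 3) ℂ) ℂ (eulerForms N) where
  smul_comm _ c ω := Subtype.ext (map_smul (pullback _) c ω.1)

lemma substLin_scalar (c : ℂ) {p : MvPolynomial (Fin 3) ℂ} {n : ℕ} (hp : p.IsHomogeneous n) :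
    substLin (Matrix.scalar (Fin 3) c) p = C (c ^ n) * p := by
  have hX : ∀ k : Fin 3, substLin (Matrix.scalar (Fin 3) c) (X k) = C c * X k := by
    intro k
    simp [substLin_X, Matrix.diagonal_apply, apply_ite C]
  conv_lhs => rw [p.as_sum]
  conv_rhs => rw [p.as_sum]
  rw [map_sum, Finset.mul_sum]
  refine Finset.sum_congr rfl fun m hm => ?_
  have hd : m.degree = n := by
    by_contra h
    exact (mem_support_iff.1 hm) (hp.coeff_eq_zero h)
  rw [monomial_eq, map_mul, substLin_C, Finsupp.prod, map_prod]
  simp only [map_pow, hX, mul_pow, Finset.prod_mul_distrib]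
  rw [Finset.prod_pow_eq_pow_sum, ← hd, Finsupp.degree_apply]
  ring

lemma pullback_scalar {N : ℕ} (c : ℂ) {ω : OneForm} (hω : ω ∈ eulerForms N) :
    pullback (Matrix.scalar (Fin 3) c) ω = c ^ (N + 2) • ω := by
  funext j
  simp only [pullback_apply, substLin_scalar c (hω.1 _)]
  simp [Matrix.diagonal_apply, MvPolynomial.smul_eq_C_mul, apply_ite C]
  ring

lemma scalar_smul_mk {N : ℕ} (u : ℂˣ) (F : ℙ ℂ (eulerForms N)) :
    Matrix.GeneralLinearGroup.scalar (Fin 3) u • F = F := by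
  induction F using Projectivization.ind with | _ ω hω =>
  rw [Projectivization.smul_mk, Projectivization.mk_eq_mk_iff']
  refine ⟨((u⁻¹ : ℂˣ) : ℂ) ^ (N + 2), Subtype.ext ?_⟩
  rw [gl_smul_val, ← map_inv, Matrix.GeneralLinearGroup.coe_scalar]
  exact (pullback_scalar _ ω.2).symm

/-- The action of `PGL₃(ℂ)`, the automorphism group of `ℙ²(ℂ)`: the class of `g` sends the class
of `ω` to the class of `(g⁻¹)^* ω`. -/
instance pglAction (N : ℕ) : MulAction PGL(3, ℂ) (ℙ ℂ (eulerForms N)) :=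
  Matrix.ProjGenLinGroup.mulActionOfGL scalar_smul_mk

lemma gl_val_ne_zero (g : GL (Fin 3) ℂ) : g.val ≠ 0 := g.ne_zero

/-- The inclusion of `PGL₃(ℂ)` in the projective space of `3 × 3` matrices, as the Zariski open
set of the classes of invertible matrices. -/
def pglToMatrix : PGL(3, ℂ) → ℙ ℂ (Matrix (Fin 3) (Fin 3) ℂ) :=
  Quotient.lift (fun g : GL (Fin 3) ℂ => Projectivization.mk ℂ g.val (gl_val_ne_zero g)) <| by
    intro g h hgh
    have hgh' : Matrix.ProjGenLinGroup.mk g = Matrix.ProjGenLinGroup.mk h := Quotient.sound hgh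
    obtain ⟨u, rfl⟩ := Matrix.ProjGenLinGroup.mk_eq_mk_iff.1 hgh'
    rw [Projectivization.mk_eq_mk_iff']
    refine ⟨((u⁻¹ : ℂˣ) : ℂ), ?_⟩
    ext i j
    simp [Matrix.mul_diagonal, mul_comm]

/-- The orbit `𝓞(F)` of `F` under the automorphisms of `ℙ²(ℂ)`. -/
def orbit {N : ℕ} (F : ℙ ℂ (eulerForms N)) : Set (ℙ ℂ (eulerForms N)) :=
  MulAction.orbit PGL(3, ℂ) F

/-- The isotropy group `Iso(F)` of `F`. -/
def iso {N : ℕ} (F : ℙ ℂ (eulerForms N)) : Subgroup PGL(3, ℂ) :=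
  MulAction.stabilizer PGL(3, ℂ) F

/-- The dimension of a subgroup of `PGL₃(ℂ)`, viewed as a subset of `ℙ(M₃(ℂ))`. -/
def groupDim (G : Subgroup PGL(3, ℂ)) : WithBot ℕ∞ :=
  zariskiDim (pglToMatrix '' (G : Set PGL(3, ℂ)))

/-! ### The foliation `F₁` -/

/-- The homogeneous one-form `(X₀² X₂ - X₁³) dX₀ + X₀ X₁² dX₁ - X₀³ dX₂`, which in the affine chart
`x = X₀`, `y = X₁`, `X₂ = 1` is `x² dx + y² (x dy - y dx)`. -/
def formOne : eulerForms 2 :=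
  ⟨![X 0 ^ 2 * X 2 - X 1 ^ 3, X 0 * X 1 ^ 2, -X 0 ^ 3], by
    refine ⟨fun i => ?_, ?_⟩
    · have h0 := isHomogeneous_X ℂ (0 : Fin 3)
      have h1 := isHomogeneous_X ℂ (1 : Fin 3)
      have h2 := isHomogeneous_X ℂ (2 : Fin 3)
      fin_cases i
      · exact ((h0.pow 2).mul h2).sub (h1.pow 3)
      · exact h0.mul (h1.pow 2)
      · exact (h0.pow 3).neg
    · simp [Fin.sum_univ_three]
      ring⟩

lemma formOne_ne_zero : formOne ≠ 0 := by
  intro h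
  have h2 : -(X 0 : MvPolynomial (Fin 3) ℂ) ^ 3 = 0 := congrFun (congrArg Subtype.val h) 2
  exact pow_ne_zero 3 (X_ne_zero (0 : Fin 3)) (neg_eq_zero.1 h2)

/-- The foliation `F₁` of degree two, defined by `x² dx + y² (x dy - y dx)`. -/
def foliationOne : ℙ ℂ (eulerForms 2) := Projectivization.mk ℂ formOne formOne_ne_zero

end PlaneFoliation

end

/-! Everything reduces to a statement about Lie algebras: the matrices `A` whose linear vector field
satisfies `L_A ω = 0` form a space of dimension at most 2 (`finrank_symmetries_le`). Granting this,
`A ↦ L_A ω` has rank at least 7 on the 9-dimensional space of matrices, and its image contains `ω`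
because `L_1 ω = (N + 2) ω` (`exists_transverse`). The cone over the orbit then has dimension at
least 7, and the cone over the isotropy group is cut out near each of its points by six independent
equations, so it has dimension at most 3. Projectivizing lowers both by one.

For the Lie algebra bound, write `f_A = ω(A)` for the contraction. A nonradial linear field cannot
be tangent to the foliation: `ω` would be parallel to the quadratic vector `X × AX`, while its
coefficients are coprime of degree `N + 1 ≥ 3` (`eq_smul_one_of_contr_eq_zero`). For two symmetries,
`f_A df_B - f_B df_A = ± f_[A,B] ω` (`contr_mul_pderiv_sub`); if they commute and `B ≠ 0`, then `f_A
/ f_B` is constant, hence `A` is a multiple of `B` (`exists_eq_smul_of_commute`). A matrix Lie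
algebra of dimension at least 3 in which commuting elements are proportional contains an
`sl₂`-triple (`exists_sl2_triple`). But `sl₂` acting on `ℂ³` has, at every vector `v`, an element
vanishing at `v` and nonzero for generic `v`; invariance of `ω` under it constrains `ω` at `v` so
strongly that a nonradial linear field becomes tangent. The two cases `e² = 0` (standard plus
trivial representation) and `e² ≠ 0` (irreducible one) are excluded separately.

Krull dimension is handled through vanishing ideals of cones. Lower bounds come from chains of
irreducible pieces, the pull-backs of `ω` by nested linear families of matrices (`le_zariskiDim`,
`vanishingIdeal_familyOrbit_lt`). Upper bounds come from the fact that dimension greater than `n`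
yields `n + 2` algebraically independent functions on a cone
(`exists_algebraicIndependent_of_not_zariskiDim_le`); these are bounded either by a Jacobian
criterion or by a parametrization with `n + 1` parameters. The latter applies to `F₁`: a
two-parameter group fixing its form normalizes a generic matrix into a 7-dimensional linear family.
-/

open scoped LinearAlgebra.Projectivization MatrixGroups

noncomputable section

namespace PlaneFoliation

open MvPolynomial

/-! ### Vanishing ideals of subsets of a projective space -/

section Zariski

variable {V : Type*} [AddCommGroup V] [Module ℂ V]

/-- The value at a vector `v` of a polynomial in the linear coordinates. -/
def evalAt (v : V) : MvPolynomial (Module.Dual ℂ V) ℂ →ₐ[ℂ] ℂ :=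
  aeval fun l : Module.Dual ℂ V => l v

lemma evalAt_X (v : V) (l : Module.Dual ℂ V) : evalAt v (X l) = l v := by
  simp [evalAt]

lemma evalAt_smul {p : MvPolynomial (Module.Dual ℂ V) ℂ} {d : ℕ} (hp : p.IsHomogeneous d) (c : ℂ)
    (v : V) : evalAt (c • v) p = c ^ d * evalAt v p := by
  simp only [evalAt, aeval_def, eval₂_eq, Finset.mul_sum, map_smul, smul_eq_mul, mul_pow,
    Finset.prod_mul_distrib]
  refine Finset.sum_congr rfl fun m hm => ?_
  have hd : m.degree = d := by
    by_contra h
    exact (mem_support_iff.1 hm) (hp.coeff_eq_zero h)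
  rw [Finset.prod_pow_eq_pow_sum, ← hd, Finsupp.degree_apply]
  ring

/-- The ideal of the polynomials in the linear coordinates which vanish on the cone over `S`. -/
def vanishingIdeal (S : Set (ℙ ℂ V)) : Ideal (MvPolynomial (Module.Dual ℂ V) ℂ) where
  carrier := {p | ∀ (v : V) (hv : v ≠ 0), Projectivization.mk ℂ v hv ∈ S → evalAt v p = 0}
  add_mem' hp hq v hv h := by rw [map_add, hp v hv h, hq v hv h, add_zero]
  zero_mem' v hv h := map_zero _
  smul_mem' c p hp v hv h := by rw [smul_eq_mul, map_mul, hp v hv h, mul_zero]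

lemma mem_vanishingIdeal {S : Set (ℙ ℂ V)} {p : MvPolynomial (Module.Dual ℂ V) ℂ} :
    p ∈ vanishingIdeal S ↔
      ∀ (v : V) (hv : v ≠ 0), Projectivization.mk ℂ v hv ∈ S → evalAt v p = 0 := Iff.rfl

lemma vanishingIdeal_anti {S T : Set (ℙ ℂ V)} (h : S ⊆ T) :
    vanishingIdeal T ≤ vanishingIdeal S := fun _ hp v hv hS => hp v hv (h hS)

lemma mk_smul_eq {c : ℂ} (hc : c ≠ 0) {v : V} (hv : v ≠ 0) :
    Projectivization.mk ℂ (c • v) (smul_ne_zero hc hv) = Projectivization.mk ℂ v hv :=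
  (Projectivization.mk_eq_mk_iff' ..).2 ⟨c, rfl⟩

lemma evalAt_rep_ne_zero {p : MvPolynomial (Module.Dual ℂ V) ℂ} {d : ℕ} (hp : p.IsHomogeneous d)
    {v : V} (hv : v ≠ 0) : evalAt (Projectivization.mk ℂ v hv).rep p ≠ 0 ↔ evalAt v p ≠ 0 := by
  obtain ⟨a, ha⟩ := Projectivization.exists_smul_eq_mk_rep ℂ v hv
  rw [← ha, Units.smul_def, evalAt_smul hp]
  simp

/-- The cone is stable under nonzero scalars, so for fixed `v` the polynomial in `c` given by `p (c
v)` has infinitely many roots and all its coefficients, the values of the homogeneous components,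
vanish. -/
lemma evalAt_homogeneousComponent {S : Set (ℙ ℂ V)} {p : MvPolynomial (Module.Dual ℂ V) ℂ}
    (hp : p ∈ vanishingIdeal S) (i : ℕ) : homogeneousComponent i p ∈ vanishingIdeal S := by
  intro v hv hS
  set P : Polynomial ℂ := ∑ d ∈ Finset.range (p.totalDegree + 1),
    Polynomial.monomial d (evalAt v (homogeneousComponent d p)) with hP
  have hzero : P = 0 := by
    refine Polynomial.eq_zero_of_infinite_isRoot P (Set.Infinite.mono ?_
      (Set.infinite_of_finite_compl (s := {0}ᶜ) (by simp) : Set.Infinite ({0}ᶜ : Set ℂ)))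
    intro c hc
    have hc' : c ≠ 0 := hc
    have h0 := hp (c • v) (smul_ne_zero hc' hv) (by rwa [mk_smul_eq hc' hv])
    rw [← sum_homogeneousComponent p, map_sum] at h0
    simp only [Set.mem_ofPred_eq, Polynomial.IsRoot.def, hP, Polynomial.eval_finsetSum,
      Polynomial.eval_monomial]
    rw [← h0]
    refine Finset.sum_congr rfl fun d _ => ?_
    rw [evalAt_smul (homogeneousComponent_isHomogeneous d p), mul_comm]
  by_cases hi : i ∈ Finset.range (p.totalDegree + 1)
  · have := congrArg (fun Q => Polynomial.coeff Q i) hzero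
    simpa [hP, Polynomial.finsetSum_coeff, Polynomial.coeff_monomial, Finset.sum_ite_eq', 
      Finset.mem_range.1 hi] using this
  · rw [homogeneousComponent_eq_zero, map_zero]
    simpa using hi

attribute [local instance] gradedAlgebra in
lemma vanishingIdeal_isHomogeneous (S : Set (ℙ ℂ V)) :
    (vanishingIdeal S).IsHomogeneous (homogeneousSubmodule (Module.Dual ℂ V) ℂ) := by
  intro i p hp
  have h := evalAt_homogeneousComponent hp i
  rwa [← decomposition.decompose'_apply] at h

lemma vanishingIdeal_ne_top {S : Set (ℙ ℂ V)} (hS : S.Nonempty) : vanishingIdeal S ≠ ⊤ := by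
  obtain ⟨x, hx⟩ := hS
  intro h
  have h1 : (1 : MvPolynomial (Module.Dual ℂ V) ℂ) ∈ vanishingIdeal S := by rw [h]; trivial
  have := h1 x.rep x.rep_nonzero (by rwa [Projectivization.mk_rep])
  simp at this

attribute [local instance] zariskiTopology

lemma isOpen_nonvanishing {p : MvPolynomial (Module.Dual ℂ V) ℂ} {d : ℕ} (hp : p.IsHomogeneous d) :
    IsOpen {x : ℙ ℂ V | evalAt x.rep p ≠ 0} :=
  TopologicalSpace.isOpen_generateFrom_of_mem ⟨d, p, hp, rfl⟩

lemma zariski_basis : TopologicalSpace.IsTopologicalBasis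
    {U : Set (ℙ ℂ V) | ∃ (d : ℕ) (p : MvPolynomial (Module.Dual ℂ V) ℂ), p.IsHomogeneous d ∧
      U = {x | evalAt x.rep p ≠ 0}} where
  exists_subset_inter := by
    rintro _ ⟨d, p, hp, rfl⟩ _ ⟨e, q, hq, rfl⟩ x hx
    refine ⟨_, ⟨d + e, p * q, hp.mul hq, rfl⟩, ?_, ?_⟩
    · simpa using hx
    · intro y hy
      simpa using hy
  sUnion_eq := by
    refine Set.eq_univ_of_forall fun x => Set.mem_sUnion.2
      ⟨_, ⟨0, 1, isHomogeneous_one _ _, rfl⟩, (?_ : evalAt x.rep 1 ≠ 0)⟩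
    rw [map_one]
    exact one_ne_zero
  eq_generateFrom := rfl

-- A homogeneous ideal can be tested for primality on homogeneous elements, and for these the
-- nonvanishing loci are open sets, which cannot be disjoint on an irreducible set if both meet it.
attribute [local instance] gradedAlgebra in
lemma vanishingIdeal_isPrime {Z : Set (ℙ ℂ V)} (hZ : IsIrreducible Z) :
    (vanishingIdeal Z).IsPrime := by
  refine (vanishingIdeal_isHomogeneous Z).isPrime_of_homogeneous_mem_or_mem
    (vanishingIdeal_ne_top hZ.nonempty) ?_
  rintro p q ⟨d, hp⟩ ⟨e, hq⟩ hpq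
  by_contra! h
  have key : ∀ {r : MvPolynomial (Module.Dual ℂ V) ℂ} {m : ℕ}, r.IsHomogeneous m →
      r ∉ vanishingIdeal Z → (Z ∩ {x | evalAt x.rep r ≠ 0}).Nonempty := by
    intro r m hr hrZ
    rw [mem_vanishingIdeal] at hrZ
    push Not at hrZ
    obtain ⟨v, hv, hvZ, hne⟩ := hrZ
    exact ⟨_, hvZ, (evalAt_rep_ne_zero hr hv).2 hne⟩
  obtain ⟨x, hxZ, hx1, hx2⟩ := hZ.isPreirreducible _ _ (isOpen_nonvanishing hp)
    (isOpen_nonvanishing hq) (key hp h.1) (key hq h.2)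
  have := hpq x.rep x.rep_nonzero (by rwa [Projectivization.mk_rep])
  rw [map_mul] at this
  exact (mul_ne_zero hx1 hx2) this

lemma isIrreducible_of_isPrime {Z : Set (ℙ ℂ V)} (hne : Z.Nonempty)
    (hZ : (vanishingIdeal Z).IsPrime) : IsIrreducible Z := by
  refine ⟨hne, fun U W hU hW ⟨x, hxZ, hxU⟩ ⟨y, hyZ, hyW⟩ => ?_⟩
  obtain ⟨_, ⟨d, p, hp, rfl⟩, hxp, hpU⟩ := zariski_basis.exists_subset_of_mem_open hxU hU
  obtain ⟨_, ⟨e, q, hq, rfl⟩, hyq, hqW⟩ := zariski_basis.exists_subset_of_mem_open hyW hW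
  have hpZ : p ∉ vanishingIdeal Z := fun h =>
    hxp (h x.rep x.rep_nonzero (by rwa [Projectivization.mk_rep]))
  have hqZ : q ∉ vanishingIdeal Z := fun h =>
    hyq (h y.rep y.rep_nonzero (by rwa [Projectivization.mk_rep]))
  have hpq : p * q ∉ vanishingIdeal Z := fun h => (hZ.mem_or_mem h).elim hpZ hqZ
  rw [mem_vanishingIdeal] at hpq
  push Not at hpq
  obtain ⟨v, hv, hvZ, h⟩ := hpq
  rw [map_mul] at h
  exact ⟨_, hvZ, hpU ((evalAt_rep_ne_zero hp hv).2 (left_ne_zero_of_mul h)),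
    hqW ((evalAt_rep_ne_zero hq hv).2 (right_ne_zero_of_mul h))⟩

lemma vanishingIdeal_le_iff_subset_closure {S T : Set (ℙ ℂ V)} :
    vanishingIdeal S ≤ vanishingIdeal T ↔ T ⊆ closure S := by
  constructor
  · intro h x hx
    rw [zariski_basis.mem_closure_iff]
    rintro _ ⟨d, p, hp, rfl⟩ hxp
    by_contra hemp
    rw [Set.not_nonempty_iff_eq_empty] at hemp
    have hpS : p ∈ vanishingIdeal S := by
      intro v hv hvS
      by_contra hne
      have : Projectivization.mk ℂ v hv ∈ {x : ℙ ℂ V | evalAt x.rep p ≠ 0} ∩ S :=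
        ⟨(evalAt_rep_ne_zero hp hv).2 hne, hvS⟩
      rw [hemp] at this
      exact this
    exact hxp (h hpS x.rep x.rep_nonzero (by rwa [Projectivization.mk_rep]))
  · intro h p hp
    rw [← sum_homogeneousComponent p]
    refine Ideal.sum_mem _ fun i _ v hv hvT => ?_
    have hi := evalAt_homogeneousComponent hp i
    have hhom := homogeneousComponent_isHomogeneous i p
    by_contra hne
    obtain ⟨y, hy, hyS⟩ := mem_closure_iff.1 (h hvT) _ (isOpen_nonvanishing hhom)
      ((evalAt_rep_ne_zero hhom hv).2 hne)
    exact hy (hi y.rep y.rep_nonzero (by rwa [Projectivization.mk_rep]))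

/-- A lower bound for the dimension: a chain of sets with strictly decreasing prime vanishing
ideals. -/
lemma le_zariskiDim {S : Set (ℙ ℂ V)} {n : ℕ} (T : Fin (n + 1) → Set (ℙ ℂ V))
    (hTS : ∀ i, T i ⊆ S) (hne : ∀ i, (T i).Nonempty) (hprime : ∀ i, (vanishingIdeal (T i)).IsPrime)
    (hlt : StrictAnti fun i => vanishingIdeal (T i)) : (n : WithBot ℕ∞) ≤ zariskiDim S := by
  have himage : ∀ i, Subtype.val '' (Subtype.val ⁻¹' T i : Set S) = T i := fun i => by
    rw [Subtype.image_preimage_coe, Set.inter_eq_right.2 (hTS i)]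
  have hirr : ∀ i, IsIrreducible (Subtype.val ⁻¹' T i : Set S) := fun i => by
    have h := isIrreducible_of_isPrime (hne i) (hprime i)
    rw [← himage i] at h
    refine ⟨by simpa using h.1.of_image, fun U W hU hW ⟨x, hx, hxU⟩ ⟨y, hy, hyW⟩ => ?_⟩
    obtain ⟨U', hU', rfl⟩ := isOpen_induced_iff.1 hU
    obtain ⟨W', hW', rfl⟩ := isOpen_induced_iff.1 hW
    obtain ⟨_, ⟨z, hz, rfl⟩, hzU, hzW⟩ := h.2 U' W' hU' hW' ⟨x, ⟨x, hx, rfl⟩, hxU⟩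
      ⟨y, ⟨y, hy, rfl⟩, hyW⟩
    exact ⟨z, hz, hzU, hzW⟩
  have hcl : ∀ i j, closure (Subtype.val ⁻¹' T i : Set S) ⊆ closure (Subtype.val ⁻¹' T j : Set S) ↔
      vanishingIdeal (T j) ≤ vanishingIdeal (T i) := by
    intro i j
    rw [vanishingIdeal_le_iff_subset_closure]
    constructor
    · intro h x hx
      have := closure_subtype.1 (h (subset_closure (a := ⟨x, hTS i hx⟩) hx))
      rwa [himage] at this
    · intro h
      refine closure_minimal (fun y hy => closure_subtype.2 ?_) isClosed_closure
      rw [himage]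
      exact h hy
  refine Order.le_krullDim_iff.2 ⟨LTSeries.mk n (fun i =>
    (⟨closure (Subtype.val ⁻¹' T i), (hirr i).closure, isClosed_closure⟩ :
      TopologicalSpace.IrreducibleCloseds S)) fun i j hij => lt_of_le_not_ge ?_ ?_, rfl⟩
  · exact (hcl i j).2 (hlt hij).le
  · exact fun h => (hlt hij).not_ge ((hcl j i).1 h)

/-- Elements chosen in the successive gaps of a chain of prime ideals are algebraically independent
modulo the smallest prime of the chain. -/
lemma aeval_mem_of_prime_chain {A : Type*} [CommRing A] [Algebra ℂ A] {n : ℕ}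
    (P : Fin (n + 1) → Ideal A) (hP : ∀ i, (P i).IsPrime) (hmono : Monotone P) (t : Fin n → A)
    (hmem : ∀ i : Fin n, t i ∈ P i.succ) (hnot : ∀ i : Fin n, t i ∉ P i.castSucc)
    (p : MvPolynomial (Fin n) ℂ) (hp : aeval t p ∈ P 0) : p = 0 := by
  induction n with
  | zero =>
    obtain ⟨c, rfl⟩ := C_surjective (Fin 0) p
    rw [aeval_C] at hp
    by_contra hc
    have hc' : c ≠ 0 := fun h => hc (by rw [h, map_zero])
    refine (hP 0).ne_top (Ideal.eq_top_of_isUnit_mem _ hp ?_)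
    exact (IsUnit.mk0 c hc').map (algebraMap ℂ A)
  | succ n ih =>
    by_contra hne
    -- View `p` as a polynomial in its first variable and remove the largest power of that variable.
    -- Since `t 0 ∉ P 0` and `P 0` is prime, the cofactor `r` still evaluates into `P 0`. Modulo `P
    -- 1`, which contains `t 0`, only the constant term of `r` survives; by induction it is zero,
    -- contradicting maximality of the power.
    set q := finSuccEquiv ℂ n p with hq
    have hq0 : q ≠ 0 := by simpa [hq] using hne
    obtain ⟨r, hr, hX⟩ := Polynomial.exists_eq_pow_rootMultiplicity_mul_and_not_dvd q hq0 0
    rw [map_zero, sub_zero] at hr hX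
    set k := q.rootMultiplicity 0
    have hpr : p = X 0 ^ k * (finSuccEquiv ℂ n).symm r := by
      apply (finSuccEquiv ℂ n).injective
      rw [map_mul, map_pow, finSuccEquiv_X_zero, AlgEquiv.apply_symm_apply]
      exact hr
    have hr0 : aeval t ((finSuccEquiv ℂ n).symm r) ∈ P 0 := by
      rw [hpr, map_mul, map_pow, aeval_X] at hp
      refine ((hP 0).mem_or_mem hp).resolve_left fun h => hnot 0 ?_
      exact (hP 0).mem_of_pow_mem _ h
    refine hX (Polynomial.X_dvd_iff.2 (ih (fun i => P i.succ) (fun i => hP _)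
      (fun i j hij => hmono (Fin.succ_le_succ_iff.2 hij)) (fun i => t i.succ)
      (fun i => hmem i.succ) (fun i => hnot i.succ) _ ?_))
    have hdecomp : (finSuccEquiv ℂ n).symm r =
        rename Fin.succ (r.coeff 0) + X 0 * (finSuccEquiv ℂ n).symm r.divX := by
      apply (finSuccEquiv ℂ n).injective
      rw [map_add, map_mul, AlgEquiv.apply_symm_apply, AlgEquiv.apply_symm_apply,
        finSuccEquiv_X_zero]
      have hC : finSuccEquiv ℂ n (rename Fin.succ (r.coeff 0)) = Polynomial.C (r.coeff 0) := by
        induction r.coeff 0 using MvPolynomial.induction_on with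
        | C a => simp [finSuccEquiv_apply]
        | add p q hp hq => simp only [map_add, hp, hq]
        | mul_X p i hp => rw [map_mul, map_mul, hp, rename_X, finSuccEquiv_X_succ, map_mul]
      rw [hC]
      conv_lhs => rw [← Polynomial.divX_mul_X_add r]
      ring
    rw [hdecomp, map_add, map_mul, aeval_X, aeval_rename] at hr0
    have h1 := hmono (Fin.zero_le (Fin.succ 0)) hr0
    exact (Ideal.add_mem_iff_left _ (Ideal.mul_mem_right _ _ (hmem 0))).1 h1

lemma constantCoeff_eq_zero_of_mem {S : Set (ℙ ℂ V)} (hS : S.Nonempty)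
    {p : MvPolynomial (Module.Dual ℂ V) ℂ} (hp : p ∈ vanishingIdeal S) : constantCoeff p = 0 := by
  obtain ⟨x, hx⟩ := hS
  have := evalAt_homogeneousComponent hp 0 x.rep x.rep_nonzero (by rwa [Projectivization.mk_rep])
  simpa [homogeneousComponent_zero, evalAt, constantCoeff_eq] using this

/-- If the dimension of `S` is not at most `n`, then `S` has an irreducible subset on whose cone
some `n + 2` polynomials are algebraically independent. -/
lemma exists_algebraicIndependent_of_not_zariskiDim_le {S : Set (ℙ ℂ V)} {n : ℕ}
    (h : ¬ zariskiDim S ≤ n) : ∃ Z ⊆ S, IsIrreducible Z ∧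
      ∃ t : Fin (n + 2) → MvPolynomial (Module.Dual ℂ V) ℂ, ∀ p : MvPolynomial (Fin (n + 2)) ℂ,
        aeval t p ∈ vanishingIdeal Z → p = 0 := by
  have hlt : ((n + 1 : ℕ) : WithBot ℕ∞) ≤ zariskiDim S := by
    obtain ⟨c, hc⟩ : ∃ c : LTSeries (TopologicalSpace.IrreducibleCloseds S),
        ¬ (c.length : WithBot ℕ∞) ≤ n := by
      by_contra! hc
      exact h (iSup_le hc)
    refine le_trans ?_ (Order.LTSeries.length_le_krullDim c)
    rw [Nat.cast_le] at hc
    exact Nat.cast_le.2 (by omega)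
  obtain ⟨c, hc⟩ := Order.le_krullDim_iff.1 hlt
  -- The chain is reversed, so that the vanishing ideals increase with the index.
  set Z : Fin (n + 2) → Set (ℙ ℂ V) := fun i =>
    Subtype.val '' ((c ⟨n + 1 - i, by omega⟩ : TopologicalSpace.IrreducibleCloseds S) : Set S) with hZ
  have hirr : ∀ i, IsIrreducible (Z i) := fun i =>
    (c _).isIrreducible.image _ continuous_subtype_val.continuousOn
  have hanti : ∀ {i j : Fin (n + 2)}, i < j → vanishingIdeal (Z i) < vanishingIdeal (Z j) := by
    intro i j hij
    have hcc : c ⟨n + 1 - j, by omega⟩ < c ⟨n + 1 - i, by omega⟩ :=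
      c.strictMono (by rw [Fin.lt_def]; simp only; omega)
    refine lt_of_le_not_ge (vanishingIdeal_anti (Set.image_mono hcc.le)) fun hle => hcc.not_ge ?_
    rw [vanishingIdeal_le_iff_subset_closure] at hle
    intro y hy
    have := closure_subtype.2 (hle ⟨y, hy, rfl⟩)
    rwa [(c _).isClosed.closure_eq] at this
  -- The ideal of the vertex of the cone is added on top of the chain. It accounts for the extra
  -- dimension of the cone: a projective chain of length `n + 1` gives `n + 2` independent
  -- functions.
  set P : Fin (n + 3) → Ideal (MvPolynomial (Module.Dual ℂ V) ℂ) :=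
    Fin.snoc (fun i => vanishingIdeal (Z i)) (RingHom.ker constantCoeff) with hPdef
  have hlast : vanishingIdeal (Z (Fin.last (n + 1))) < RingHom.ker constantCoeff := by
    have hle : vanishingIdeal (Z (Fin.last (n + 1))) ≤ RingHom.ker constantCoeff :=
      fun p hp => constantCoeff_eq_zero_of_mem (hirr _).nonempty hp
    refine lt_of_le_not_ge hle fun hge => ?_
    obtain ⟨x, hx⟩ := (hirr (Fin.last (n + 1))).nonempty
    obtain ⟨l, hl⟩ : ∃ l : Module.Dual ℂ V, l x.rep ≠ 0 := by
      by_contra! hl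
      exact x.rep_nonzero ((Module.forall_dual_apply_eq_zero_iff ℂ _).1 hl)
    have hX : (X l : MvPolynomial (Module.Dual ℂ V) ℂ) ∈ RingHom.ker constantCoeff := by
      simp [RingHom.mem_ker]
    have := hge hX x.rep x.rep_nonzero (by rwa [Projectivization.mk_rep])
    rw [evalAt_X] at this
    exact hl this
  have hstep : ∀ i : Fin (n + 2), P i.castSucc < P i.succ := by
    intro i
    induction i using Fin.lastCases with
    | last => simpa [hPdef, Fin.snoc_castSucc, Fin.succ_last, Fin.snoc_last] using hlast
    | cast i =>
      rw [hPdef, Fin.snoc_castSucc, Fin.succ_castSucc, Fin.snoc_castSucc]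
      exact hanti (Fin.castSucc_lt_succ)
  have hex : ∀ i : Fin (n + 2), ∃ t, t ∈ P i.succ ∧ t ∉ P i.castSucc := fun i =>
    SetLike.exists_of_lt (hstep i)
  choose t ht using hex
  refine ⟨Z 0, ?_, hirr 0, t, fun p hp => ?_⟩
  · rintro _ ⟨y, _, rfl⟩
    exact y.2
  · refine aeval_mem_of_prime_chain P ?_ (Fin.monotone_iff_le_succ.2 fun i => (hstep i).le) t
      (fun i => (ht i).1) (fun i => (ht i).2) p ?_
    · intro i
      induction i using Fin.lastCases with
      | last =>
        rw [hPdef, Fin.snoc_last]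
        exact RingHom.ker_isPrime _
      | cast i =>
        rw [hPdef, Fin.snoc_castSucc]
        exact vanishingIdeal_isPrime (hirr i)
    · rw [hPdef, ← Fin.castSucc_zero, Fin.snoc_castSucc]
      exact hp

/-- The dimension of a set contained in the closure of the image of a polynomial map. -/
lemma zariskiDim_le_of_algHom {S : Set (ℙ ℂ V)} {n : ℕ}
    (θ : MvPolynomial (Module.Dual ℂ V) ℂ →ₐ[ℂ] MvPolynomial (Fin (n + 1)) ℂ)
    (h : RingHom.ker θ ≤ vanishingIdeal S) : zariskiDim S ≤ n := by
  by_contra hn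
  obtain ⟨Z, hZS, -, t, ht⟩ := exists_algebraicIndependent_of_not_zariskiDim_le hn
  have hind : AlgebraicIndependent ℂ fun i => θ (t i) := by
    rw [algebraicIndependent_iff]
    intro p hp
    refine ht p (vanishingIdeal_anti hZS (h ?_))
    rw [RingHom.mem_ker]
    rw [← hp]
    exact (comp_aeval_apply _ _ _)
  have := hind.lift_cardinalMk_le_trdeg
  rw [MvPolynomial.trdeg_of_isDomain] at this
  -- The `n + 2` independent elements would live in a polynomial ring in `n + 1` variables.
  simp only [Cardinal.mk_fin, Cardinal.lift_natCast] at this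
  have h2 : n + 2 ≤ n + 1 := by exact_mod_cast this
  omega

end Zariski

/-! ### The Jacobian bound for the transcendence degree -/

lemma derivation_aeval {R A M ι : Type*} [CommRing R] [CommRing A] [Algebra R A] [AddCommGroup M]
    [Module A M] [Module R M] [IsScalarTower R A M] [Fintype ι] (D : Derivation R A M) (y : ι → A)
    (p : MvPolynomial ι R) : D (aeval y p) = ∑ i, aeval y (pderiv i p) • D (y i) := by
  classical
  induction p using MvPolynomial.induction_on with
  | C a => simp
  | add p q hp hq => simp only [map_add, hp, hq, add_smul, Finset.sum_add_distrib]
  | mul_X p j hp =>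
    rw [map_mul, aeval_X, D.leibniz, hp]
    simp only [Derivation.leibniz, map_add, smul_eq_mul, map_mul, aeval_X, pderiv_X, add_smul,
      Finset.sum_add_distrib, Finset.smul_sum, smul_smul]
    congr 1
    simp [Pi.single_apply, apply_ite (aeval y), Finset.sum_ite_eq]

-- Over the subfield `B` generated by the `κ`-coordinates, differentiating the relations gives a
-- linear system for the differentials of the `ρ`-coordinates with invertible matrix. Hence the
-- Kähler differentials of `K` over `B` vanish, `K` is separable algebraic over `B`, and the
-- `κ`-coordinates contain a transcendence basis.
open scoped IntermediateField.algebraAdjoinAdjoin in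
lemma trdeg_le_of_jacobian {K κ ρ : Type} [Field K] [Algebra ℂ K] [Fintype κ] [Fintype ρ]
    [DecidableEq ρ] (y : κ ⊕ ρ → K) (hgen : IntermediateField.adjoin ℂ (Set.range y) = ⊤)
    (p : ρ → MvPolynomial (κ ⊕ ρ) ℂ) (hp : ∀ i, aeval y (p i) = 0)
    (hdet : (Matrix.of fun i j => aeval y (pderiv (Sum.inr j) (p i))).det ≠ 0) :
    Algebra.trdeg ℂ K ≤ Fintype.card κ := by
  set s : Set K := Set.range fun i => y (Sum.inl i)
  let B := IntermediateField.adjoin ℂ s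
  have hess : Algebra.EssFiniteType ℂ K := by
    rw [← IntermediateField.fg_top_iff, ← hgen]
    exact IntermediateField.fg_adjoin_of_finite (Set.finite_range y)
  have hessB : Algebra.EssFiniteType B K := .of_comp ℂ B K
  let D := KaehlerDifferential.D B K
  have hinl : ∀ i, D (y (Sum.inl i)) = 0 := fun i =>
    D.map_algebraMap (⟨y (Sum.inl i), IntermediateField.subset_adjoin _ _ ⟨i, rfl⟩⟩ : B)
  have hinr : ∀ j, D (y (Sum.inr j)) = 0 := by
    set J : Matrix ρ ρ K := Matrix.of fun i j => aeval y (pderiv (Sum.inr j) (p i)) with hJ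
    have hrel : ∀ i, ∑ j, J i j • D (y (Sum.inr j)) = 0 := by
      intro i
      have h := derivation_aeval (D.restrictScalars ℂ) y (p i)
      rw [hp i, map_zero, Fintype.sum_sum_type] at h
      simpa [hinl, hJ] using h.symm
    intro k
    have hu : IsUnit J.det := isUnit_iff_ne_zero.2 hdet
    have h1 : ∑ i, J⁻¹ k i • ∑ j, J i j • D (y (Sum.inr j)) = D (y (Sum.inr k)) := by
      simp only [Finset.smul_sum, smul_smul]
      rw [Finset.sum_comm]
      simp only [← Finset.sum_smul, ← Matrix.mul_apply, Matrix.nonsing_inv_mul J hu,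
        Matrix.one_apply, ite_smul, one_smul, zero_smul]
      simp
    rw [← h1]
    simp [hrel]
  have hD : ∀ x : K, D x = 0 := by
    intro x
    have hx : x ∈ IntermediateField.adjoin ℂ (Set.range y) := by rw [hgen]; trivial
    induction hx using IntermediateField.adjoin_induction with
    | mem x hx =>
      obtain ⟨i | j, rfl⟩ := hx
      · exact hinl i
      · exact hinr j
    | algebraMap c => exact D.map_algebraMap (algebraMap ℂ B c)
    | add x z _ _ hx hz => rw [map_add, hx, hz, add_zero]
    | inv x _ hx => rw [D.leibniz_inv, hx, smul_zero]
    | mul x z _ _ hx hz => rw [D.leibniz, hx, hz, smul_zero, smul_zero, add_zero]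
  have hsub : Subsingleton (Ω[K⁄B]) := by
    rw [← Submodule.subsingleton_iff K, ← subsingleton_iff_bot_eq_top,
      ← KaehlerDifferential.span_range_derivation, eq_comm, Submodule.span_eq_bot]
    rintro _ ⟨x, rfl⟩
    exact hD x
  have hunr : Algebra.FormallyUnramified B K := ⟨hsub⟩
  have hsep : Algebra.IsSeparable B K := (Algebra.FormallyUnramified.iff_isSeparable B K).1 hunr
  have halg : Algebra.IsAlgebraic (Algebra.adjoin ℂ s) K :=
    (IsFractionRing.comap_isAlgebraic_iff (A := Algebra.adjoin ℂ s) (K := B) (C := K)).2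
      inferInstance
  refine (Algebra.IsAlgebraic.trdeg_le_cardinalMk ℂ s).trans ?_
  exact Cardinal.mk_range_le.trans (by simp)

/-! ### The Jacobian criterion for dimension in projective space -/

section Zariski

variable {V : Type} [AddCommGroup V] [Module ℂ V]

attribute [local instance] zariskiTopology

lemma evalAt_rename {ι : Type*} (b : ι → Module.Dual ℂ V) (v : V) (p : MvPolynomial ι ℂ) :
    evalAt v (rename b p) = eval (fun i => b i v) p := by
  simp [evalAt, aeval_rename, aeval_eq_eval, Function.comp_def]

/-- The Jacobian criterion for the dimension of a subset of a projective space. -/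
lemma zariskiDim_le_of_jacobian {S : Set (ℙ ℂ V)} {κ ρ : Type} [Fintype κ] [Fintype ρ]
    [DecidableEq ρ] {n : ℕ} (hκ : Fintype.card κ ≤ n + 1)
    (h : ∀ (w : V) (hw : w ≠ 0), Projectivization.mk ℂ w hw ∈ S →
      ∃ (b : Module.Basis (κ ⊕ ρ) ℂ V) (p : ρ → MvPolynomial (κ ⊕ ρ) ℂ),
        (∀ (v : V) (hv : v ≠ 0), Projectivization.mk ℂ v hv ∈ S → ∀ i, eval (b.repr v) (p i) = 0) ∧
        (Matrix.of fun i j => eval (b.repr w) (pderiv (Sum.inr j) (p i))).det ≠ 0) :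
    zariskiDim S ≤ n := by
  by_contra hn
  obtain ⟨Z, hZS, hZ, t, ht⟩ := exists_algebraicIndependent_of_not_zariskiDim_le hn
  have hprime := vanishingIdeal_isPrime hZ
  -- A single point of `Z` suffices: the relations chosen for it hold on all of `S`, and a Jacobian
  -- determinant nonzero at one point of `Z` is nonzero in the function field `K` of the cone over
  -- `Z`.
  obtain ⟨x, hx⟩ := hZ.nonempty
  obtain ⟨b, p, hp, hdet⟩ := h x.rep x.rep_nonzero (hZS (by rwa [Projectivization.mk_rep]))
  let R := MvPolynomial (Module.Dual ℂ V) ℂ ⧸ vanishingIdeal Z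
  let K := FractionRing R
  let π : MvPolynomial (Module.Dual ℂ V) ℂ →ₐ[ℂ] K :=
    (IsScalarTower.toAlgHom ℂ R K).comp (Ideal.Quotient.mkₐ ℂ (vanishingIdeal Z))
  have hπ : ∀ q, π q = 0 ↔ q ∈ vanishingIdeal Z := by
    intro q
    change algebraMap R K (Ideal.Quotient.mk _ q) = 0 ↔ _
    rw [FaithfulSMul.algebraMap_eq_zero_iff, Ideal.Quotient.eq_zero_iff_mem]
  let y : κ ⊕ ρ → K := fun i => π (X (b.coord i))
  have hy : ∀ q : MvPolynomial (κ ⊕ ρ) ℂ, aeval y q = π (rename b.coord q) := by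
    intro q
    rw [← AlgHom.comp_apply]
    congr 1
    apply MvPolynomial.algHom_ext
    intro i
    simp [y]
  have hy0 : ∀ q : MvPolynomial (κ ⊕ ρ) ℂ, aeval y q = 0 ↔
      ∀ (v : V) (hv : v ≠ 0), Projectivization.mk ℂ v hv ∈ Z → eval (b.repr v) q = 0 := by
    intro q
    rw [hy, hπ, mem_vanishingIdeal]
    simp only [evalAt_rename]
    rfl
  have hgen : IntermediateField.adjoin ℂ (Set.range y) = ⊤ := by
    set F := IntermediateField.adjoin ℂ (Set.range y)
    have hyF : ∀ i, y i ∈ F := fun i => IntermediateField.subset_adjoin _ _ ⟨i, rfl⟩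
    have hπF : ∀ q, π q ∈ F := by
      intro q
      induction q using MvPolynomial.induction_on with
      | C c =>
        have : π (C c) = algebraMap ℂ K c := π.commutes c
        rw [this]
        exact F.algebraMap_mem c
      | add q r hq hr => rw [map_add]; exact F.add_mem hq hr
      | mul_X q l hq =>
        rw [map_mul]
        refine F.mul_mem hq ?_
        -- The ring has one variable for every linear functional; modulo the vanishing ideal each is
        -- a combination of the coordinates in the basis `b`, so these generate `K`.
        have hl : π (X l - ∑ i, C (l (b i)) * X (b.coord i)) = 0 := by
          rw [hπ]
          intro v hv _
          simp only [map_sub, map_sum, map_mul, evalAt_X]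
          rw [sub_eq_zero]
          conv_lhs => rw [← b.sum_repr v, map_sum]
          simp only [map_smul, smul_eq_mul]
          refine Finset.sum_congr rfl fun i _ => ?_
          rw [mul_comm, Module.Basis.coord_apply]
          simp [evalAt]
        rw [map_sub, sub_eq_zero] at hl
        rw [hl, map_sum]
        refine F.sum_mem fun i _ => ?_
        rw [map_mul]
        exact F.mul_mem (by
          have : π (C (l (b i))) = algebraMap ℂ K (l (b i)) := π.commutes _
          rw [this]
          exact F.algebraMap_mem _) (hyF i)
    refine eq_top_iff.2 fun z _ => ?_
    obtain ⟨a, c, -, rfl⟩ := IsFractionRing.div_surjective (A := R) z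
    obtain ⟨a, rfl⟩ := Ideal.Quotient.mk_surjective a
    obtain ⟨c, rfl⟩ := Ideal.Quotient.mk_surjective c
    exact F.div_mem (hπF a) (hπF c)
  have htr := trdeg_le_of_jacobian y hgen p (fun i => (hy0 _).2 fun v hv hvZ => hp v hv (hZS hvZ) i)
    (by
      intro h0
      apply hdet
      have h1 := (aeval y).map_det (Matrix.of fun i j => pderiv (Sum.inr j) (p i))
      have h2 := (eval (b.repr x.rep)).map_det (Matrix.of fun i j => pderiv (Sum.inr j) (p i))
      refine h2.symm.trans ((hy0 _).1 (h1.trans h0) x.rep x.rep_nonzero ?_)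
      rwa [Projectivization.mk_rep])
  have hind : AlgebraicIndependent ℂ fun i => π (t i) := by
    rw [algebraicIndependent_iff]
    intro q hq
    refine ht q ((hπ _).1 ?_)
    rw [← hq]
    exact (comp_aeval_apply _ _ _)
  have hle := hind.lift_cardinalMk_le_trdeg
  simp only [Cardinal.mk_fin, Cardinal.lift_id] at hle
  have h2 : n + 2 ≤ Fintype.card κ := by exact_mod_cast hle.trans htr
  omega

end Zariski

/-! ### Pull-backs by matrices over a `ℂ`-algebra -/

section Pullback

variable {R S : Type*} [CommRing R] [Algebra ℂ R] [CommRing S] [Algebra ℂ S]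

/-- The substitution `p(x) ↦ p(M x)` for a matrix `M` over a `ℂ`-algebra. -/
def substLinOver (M : Matrix (Fin 3) (Fin 3) R) :
    MvPolynomial (Fin 3) ℂ →ₐ[ℂ] MvPolynomial (Fin 3) R :=
  aeval fun k => ∑ l, C (M k l) * X l

/-- The pull-back of a one-form by a matrix over a `ℂ`-algebra. -/
def pullbackOver (M : Matrix (Fin 3) (Fin 3) R) (ω : OneForm) : Fin 3 → MvPolynomial (Fin 3) R :=
  fun j => ∑ i, C (M i j) * substLinOver M (ω i)

lemma substLinOver_X (M : Matrix (Fin 3) (Fin 3) R) (k : Fin 3) :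
    substLinOver M (X k) = ∑ l, C (M k l) * X l := by
  simp [substLinOver]

lemma substLinOver_C (M : Matrix (Fin 3) (Fin 3) R) (c : ℂ) :
    substLinOver M (C c) = C (algebraMap ℂ R c) := by
  simp [substLinOver, algebraMap_eq, IsScalarTower.algebraMap_apply ℂ R (MvPolynomial (Fin 3) R)]

lemma pullbackOver_self (M : Matrix (Fin 3) (Fin 3) ℂ) (ω : OneForm) :
    pullbackOver M ω = pullback M ω := rfl

lemma map_substLinOver (φ : R →ₐ[ℂ] S) (M : Matrix (Fin 3) (Fin 3) R)
    (p : MvPolynomial (Fin 3) ℂ) :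
    mapAlgHom φ (substLinOver M p) = substLinOver (M.map φ) p := by
  have h : (mapAlgHom φ).comp (substLinOver M) = substLinOver (M.map φ) := by
    apply MvPolynomial.algHom_ext
    intro k
    simp [substLinOver_X]
  exact DFunLike.congr_fun h p

lemma map_pullbackOver (φ : R →ₐ[ℂ] S) (M : Matrix (Fin 3) (Fin 3) R) (ω : OneForm) (j : Fin 3) :
    mapAlgHom φ (pullbackOver M ω j) = pullbackOver (M.map φ) ω j := by
  simp only [pullbackOver, map_sum, map_mul, map_substLinOver]
  simp

lemma substLinOver_mul (M : Matrix (Fin 3) (Fin 3) ℂ) (N : Matrix (Fin 3) (Fin 3) R)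
    (p : MvPolynomial (Fin 3) ℂ) :
    substLinOver (M.map (algebraMap ℂ R) * N) p = substLinOver N (substLin M p) := by
  have h : substLinOver (M.map (algebraMap ℂ R) * N) = (substLinOver N).comp (substLin M) := by
    apply MvPolynomial.algHom_ext
    intro k
    simp only [AlgHom.comp_apply, substLin_X, substLinOver_X, map_sum, map_mul, substLinOver_C,
      Matrix.mul_apply, Finset.sum_mul, Finset.mul_sum, mul_assoc, Matrix.map_apply]
    exact Finset.sum_comm
  exact DFunLike.congr_fun h p

lemma pullbackOver_mul (M : Matrix (Fin 3) (Fin 3) ℂ) (N : Matrix (Fin 3) (Fin 3) R)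
    (ω : OneForm) :
    pullbackOver (M.map (algebraMap ℂ R) * N) ω = pullbackOver N (pullback M ω) := by
  funext j
  simp only [pullbackOver, pullback_apply, substLinOver_mul, map_sum, map_mul, substLinOver_C,
    Matrix.mul_apply, Finset.sum_mul, Finset.mul_sum, Matrix.map_apply]
  rw [Finset.sum_comm]
  refine Finset.sum_congr rfl fun i _ => Finset.sum_congr rfl fun k _ => ?_
  ring

/-- The extension of scalars of a linear functional on one-forms. -/
def extendDual (R : Type*) [CommRing R] [Algebra ℂ R] (l : Module.Dual ℂ OneForm) :
    (Fin 3 → MvPolynomial (Fin 3) R) →ₗ[R] R :=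
  ∑ j, ((basisMonomials (Fin 3) R).constr R fun m =>
    algebraMap ℂ R (l (Pi.single j (monomial m 1)))).comp (LinearMap.proj j)

omit [Algebra ℂ R] in
lemma constr_basisMonomials (f : (Fin 3 →₀ ℕ) → R) (m : Fin 3 →₀ ℕ) (c : R) :
    (basisMonomials (Fin 3) R).constr R f (monomial m c) = c * f m := by
  have : monomial m c = c • basisMonomials (Fin 3) R m := by
    simp [smul_monomial]
  rw [this, map_smul, Module.Basis.constr_basis, smul_eq_mul]

lemma extendDual_apply (l : Module.Dual ℂ OneForm) (G : Fin 3 → MvPolynomial (Fin 3) R) :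
    extendDual R l G = ∑ j, (basisMonomials (Fin 3) R).constr R
      (fun m => algebraMap ℂ R (l (Pi.single j (monomial m 1)))) (G j) := by
  simp [extendDual]

lemma extendDual_self (l : Module.Dual ℂ OneForm) (ω : OneForm) : extendDual ℂ l ω = l ω := by
  have key : ∀ (j : Fin 3) (p : MvPolynomial (Fin 3) ℂ), (basisMonomials (Fin 3) ℂ).constr ℂ
      (fun m => algebraMap ℂ ℂ (l (Pi.single j (monomial m 1)))) p = l (Pi.single j p) := by
    intro j p
    induction p using MvPolynomial.induction_on' with
    | monomial m c =>
      rw [constr_basisMonomials, Algebra.algebraMap_self, RingHom.id_apply, ← smul_eq_mul,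
        ← map_smul, ← Pi.single_smul, smul_monomial, smul_eq_mul, mul_one]
    | add p q hp hq => rw [map_add, hp, hq, Pi.single_add, map_add]
  rw [extendDual_apply]
  simp only [key]
  rw [← map_sum, Finset.univ_sum_single]

lemma extendDual_map (φ : R →ₐ[ℂ] S) (l : Module.Dual ℂ OneForm)
    (G : Fin 3 → MvPolynomial (Fin 3) R) :
    extendDual S l (fun j => mapAlgHom φ (G j)) = φ (extendDual R l G) := by
  have key : ∀ (j : Fin 3) (p : MvPolynomial (Fin 3) R), (basisMonomials (Fin 3) S).constr S
      (fun m => algebraMap ℂ S (l (Pi.single j (monomial m 1)))) (mapAlgHom φ p) =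
      φ ((basisMonomials (Fin 3) R).constr R
        (fun m => algebraMap ℂ R (l (Pi.single j (monomial m 1)))) p) := by
    intro j p
    induction p using MvPolynomial.induction_on' with
    | monomial m c =>
      have h : mapAlgHom φ (monomial m c) = monomial m (φ c) := by
        rw [mapAlgHom_apply, map_monomial]
        rfl
      rw [h, constr_basisMonomials, constr_basisMonomials, map_mul, AlgHom.commutes]
    | add p q hp hq => simp only [map_add, hp, hq]
  simp only [extendDual_apply, key, map_sum]

lemma extendDual_algebraMap (l : Module.Dual ℂ OneForm) (ω : OneForm) :
    extendDual R l (fun j => mapAlgHom (Algebra.ofId ℂ R) (ω j)) = algebraMap ℂ R (l ω) := by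
  rw [extendDual_map, extendDual_self]
  rfl

end Pullback

/-! ### The polynomial functions `g ↦ l (g^* ω)` and their derivatives -/

/-- The polynomial in the entries of a matrix `g` whose value is `l (pullback g ω)`. -/
def orbitPoly (l : Module.Dual ℂ OneForm) (ω : OneForm) : MvPolynomial (Fin 3 × Fin 3) ℂ :=
  extendDual _ l (pullbackOver (Matrix.of fun i j => X (i, j)) ω)

lemma aeval_orbitPoly {R : Type*} [CommRing R] [Algebra ℂ R] (l : Module.Dual ℂ OneForm)
    (ω : OneForm) (M : Matrix (Fin 3) (Fin 3) R) :
    aeval (fun ij : Fin 3 × Fin 3 => M ij.1 ij.2) (orbitPoly l ω) =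
      extendDual R l (pullbackOver M ω) := by
  rw [orbitPoly, ← extendDual_map]
  congr 1
  funext j
  rw [map_pullbackOver]
  congr 1
  ext i k
  simp

lemma eval_orbitPoly (l : Module.Dual ℂ OneForm) (ω : OneForm) (g : Matrix (Fin 3) (Fin 3) ℂ) :
    eval (fun ij : Fin 3 × Fin 3 => g ij.1 ij.2) (orbitPoly l ω) = l (pullback g ω) := by
  have := aeval_orbitPoly l ω g
  rw [extendDual_self, pullbackOver_self] at this
  rw [← this, aeval_eq_eval]

/-- First-order Taylor expansion over `ℂ[ε]`; it serves to read off derivatives of `orbitPoly` from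
pull-backs by matrices over the dual numbers. -/
lemma aeval_dualNumber {ι : Type*} [Fintype ι] (g b : ι → ℂ) (p : MvPolynomial ι ℂ) :
    aeval (fun i => (TrivSqZeroExt.inl (g i) + TrivSqZeroExt.inr (b i) : DualNumber ℂ)) p =
      TrivSqZeroExt.inl (eval g p) + TrivSqZeroExt.inr (∑ i, eval g (pderiv i p) * b i) := by
  classical
  induction p using MvPolynomial.induction_on with
  | C a =>
    rw [aeval_C]
    ext <;> simp [TrivSqZeroExt.algebraMap_eq_inl]
  | add p q hp hq =>
    rw [map_add, hp, hq]
    ext <;> simp [add_mul, Finset.sum_add_distrib]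
  | mul_X p j hp =>
    rw [map_mul, hp, aeval_X]
    ext
    · simp
    · have h : ∀ i, eval g (pderiv i (p * X j)) * b i =
          g j * (eval g (pderiv i p) * b i) + if i = j then eval g p * b j else 0 := by
        intro i
        by_cases hij : i = j
        · subst hij
          rw [Derivation.leibniz, pderiv_X_self, if_pos rfl]
          simp
          ring
        · rw [Derivation.leibniz, pderiv_X_of_ne (Ne.symm hij), if_neg hij]
          simp
          ring
      simp only [h, Finset.sum_add_distrib, ← Finset.mul_sum, Finset.sum_ite_eq',
        Finset.mem_univ, if_true]
      simp
      ring

/-- The derivation of the polynomial ring defined by the linear vector field `x ↦ A x`. -/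
def linDeriv (A : Matrix (Fin 3) (Fin 3) ℂ) :
    Derivation ℂ (MvPolynomial (Fin 3) ℂ) (MvPolynomial (Fin 3) ℂ) :=
  mkDerivation ℂ fun k => ∑ l, C (A k l) * X l

lemma linDeriv_X (A : Matrix (Fin 3) (Fin 3) ℂ) (k : Fin 3) :
    linDeriv A (X k) = ∑ l, C (A k l) * X l := mkDerivation_X _ _ _

/-- The Lie derivative of a one-form along the linear vector field `x ↦ A x`. -/
def lieDeriv (ω : OneForm) : Matrix (Fin 3) (Fin 3) ℂ →ₗ[ℂ] OneForm where
  toFun A := fun j => ∑ i, C (A i j) * ω i + linDeriv A (ω j)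
  map_add' A B := by
    have : linDeriv (A + B) = linDeriv A + linDeriv B := by
      apply derivation_ext
      intro k
      simp [linDeriv_X, add_mul, Finset.sum_add_distrib]
    funext j
    simp only [this, Matrix.add_apply, C_add, add_mul, Finset.sum_add_distrib,
      Derivation.add_apply, Pi.add_apply]
    ring
  map_smul' c A := by
    have : linDeriv (c • A) = c • linDeriv A := by
      apply derivation_ext
      intro k
      simp [linDeriv_X, Finset.smul_sum, MvPolynomial.smul_eq_C_mul, mul_assoc]
    funext j
    simp only [this, Matrix.smul_apply, smul_eq_mul, C_mul, mul_assoc, ← Finset.mul_sum,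
      Derivation.smul_apply, Pi.smul_apply, RingHom.id_apply, MvPolynomial.smul_eq_C_mul, mul_add]

lemma lieDeriv_apply (ω : OneForm) (A : Matrix (Fin 3) (Fin 3) ℂ) (j : Fin 3) :
    lieDeriv ω A j = ∑ i, C (A i j) * ω i + linDeriv A (ω j) := rfl

lemma mapAlgHom_C_ofId {R : Type*} [CommRing R] [Algebra ℂ R] (c : ℂ) :
    mapAlgHom (Algebra.ofId ℂ R) (C c : MvPolynomial (Fin 3) ℂ) = C (algebraMap ℂ R c) := by
  simp

section Infinitesimal

variable {R : Type*} [CommRing R] [Algebra ℂ R] (ε : R)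

/-- The matrix `1 + ε A`. -/
def infinitesimal (A : Matrix (Fin 3) (Fin 3) ℂ) : Matrix (Fin 3) (Fin 3) R :=
  1 + ε • A.map (algebraMap ℂ R)

lemma infinitesimal_apply (A : Matrix (Fin 3) (Fin 3) ℂ) (i j : Fin 3) :
    infinitesimal ε A i j = (1 : Matrix (Fin 3) (Fin 3) R) i j + ε * algebraMap ℂ R (A i j) := rfl

lemma substLinOver_infinitesimal {ε : R} (hε : ε * ε = 0) (A : Matrix (Fin 3) (Fin 3) ℂ)
    (p : MvPolynomial (Fin 3) ℂ) :
    substLinOver (infinitesimal ε A) p = mapAlgHom (Algebra.ofId ℂ R) p +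
      C ε * mapAlgHom (Algebra.ofId ℂ R) (linDeriv A p) := by
  have hC : (C ε : MvPolynomial (Fin 3) R) * C ε = 0 := by rw [← C_mul, hε, C_0]
  induction p using MvPolynomial.induction_on with
  | C a =>
    rw [substLinOver_C, mapAlgHom_C_ofId, derivation_C, map_zero, mul_zero, add_zero]
  | add p q hp hq => rw [map_add, hp, hq, map_add, map_add, map_add]; ring
  | mul_X p k hp =>
    have hX : substLinOver (infinitesimal ε A) (X k) = mapAlgHom (Algebra.ofId ℂ R) (X k) +
        C ε * mapAlgHom (Algebra.ofId ℂ R) (linDeriv A (X k)) := by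
      have hm : ∀ i : Fin 3, mapAlgHom (Algebra.ofId ℂ R) (X i : MvPolynomial (Fin 3) ℂ) = X i :=
        fun i => by rw [mapAlgHom_apply, map_X]
      have hterm : ∀ l, C (infinitesimal ε A k l) * (X l : MvPolynomial (Fin 3) R) =
          (if k = l then X l else 0) +
            C ε * mapAlgHom (Algebra.ofId ℂ R) (C (A k l) * X l) := by
        intro l
        rw [infinitesimal_apply, Matrix.one_apply, map_mul, mapAlgHom_C_ofId, hm, C_add, C_mul]
        split_ifs
        · rw [C_1]; ring
        · rw [C_0]; ring
      rw [substLinOver_X, linDeriv_X, hm]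
      simp only [hterm, Finset.sum_add_distrib, Finset.sum_ite_eq, Finset.mem_univ, if_true,
        ← Finset.mul_sum, ← map_sum]
    rw [map_mul, hp, hX, Derivation.leibniz, smul_eq_mul, smul_eq_mul, map_mul, map_add, map_mul,
      map_mul]
    linear_combination (mapAlgHom (Algebra.ofId ℂ R) (linDeriv A p)) *
      (mapAlgHom (Algebra.ofId ℂ R) (linDeriv A (X k))) * hC

/-- This identifies `lieDeriv` as the derivative at the identity of the pull-back by `1 + ε A`. -/
lemma pullbackOver_infinitesimal {ε : R} (hε : ε * ε = 0) (A : Matrix (Fin 3) (Fin 3) ℂ)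
    (ω : OneForm) :
    pullbackOver (infinitesimal ε A) ω = (fun j => mapAlgHom (Algebra.ofId ℂ R) (ω j)) +
      ε • fun j => mapAlgHom (Algebra.ofId ℂ R) (lieDeriv ω A j) := by
  have hC : (C ε : MvPolynomial (Fin 3) R) * C ε = 0 := by rw [← C_mul, hε, C_0]
  set m := mapAlgHom (σ := Fin 3) (Algebra.ofId ℂ R) with hm
  funext j
  have hterm : ∀ i, C (infinitesimal ε A i j) * substLinOver (infinitesimal ε A) (ω i) =
      (if i = j then m (ω i) + C ε * m (linDeriv A (ω i)) else 0) +
        C ε * m (C (A i j) * ω i) := by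
    intro i
    rw [substLinOver_infinitesimal hε, infinitesimal_apply, Matrix.one_apply, map_mul, hm,
      mapAlgHom_C_ofId, C_add, C_mul]
    split_ifs
    · rw [C_1]
      linear_combination C (algebraMap ℂ R (A i j)) * m (linDeriv A (ω i)) * hC
    · rw [C_0]
      linear_combination C (algebraMap ℂ R (A i j)) * m (linDeriv A (ω i)) * hC
  simp only [pullbackOver, hterm, Finset.sum_add_distrib, Finset.sum_ite_eq', Finset.mem_univ,
    if_true, ← Finset.mul_sum, ← map_sum, Pi.add_apply, Pi.smul_apply, lieDeriv_apply, map_add,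
    MvPolynomial.smul_eq_C_mul]
  ring

end Infinitesimal

/-- The derivative of `orbitPoly l ω` at `g` in the direction `g A`. -/
lemma sum_pderiv_orbitPoly (l : Module.Dual ℂ OneForm) (ω : OneForm)
    (g A : Matrix (Fin 3) (Fin 3) ℂ) :
    ∑ ij : Fin 3 × Fin 3, eval (fun ij : Fin 3 × Fin 3 => g ij.1 ij.2)
      (pderiv ij (orbitPoly l ω)) * (g * A) ij.1 ij.2 = l (lieDeriv (pullback g ω) A) := by
  have h1 := aeval_dualNumber (fun ij : Fin 3 × Fin 3 => g ij.1 ij.2)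
    (fun ij : Fin 3 × Fin 3 => (g * A) ij.1 ij.2) (orbitPoly l ω)
  -- Since `g + ε g A = g (1 + ε A)`, the perturbed pull-back of `ω` is the infinitesimal pull-back
  -- of `g^* ω`.
  have hM : (fun ij : Fin 3 × Fin 3 => (TrivSqZeroExt.inl (g ij.1 ij.2) +
      TrivSqZeroExt.inr ((g * A) ij.1 ij.2) : DualNumber ℂ)) =
      fun ij => (g.map (algebraMap ℂ (DualNumber ℂ)) *
        infinitesimal (DualNumber.eps : DualNumber ℂ) A : Matrix _ _ (DualNumber ℂ)) ij.1 ij.2 := by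
    funext ij
    rw [infinitesimal, mul_add, mul_one, Matrix.mul_smul, ← Matrix.map_mul]
    ext <;> simp [TrivSqZeroExt.algebraMap_eq_inl]
  rw [hM, aeval_orbitPoly, pullbackOver_mul, pullbackOver_infinitesimal
    DualNumber.eps_mul_eps, map_add, map_smul, extendDual_algebraMap, extendDual_algebraMap] at h1
  have h2 := congrArg TrivSqZeroExt.snd h1
  simpa [TrivSqZeroExt.algebraMap_eq_inl] using h2.symm

/-- Linear substitution of variables. -/
def linSubst {ι τ : Type*} [Fintype ι] (b : ι → τ → ℂ) :
    MvPolynomial τ ℂ →ₐ[ℂ] MvPolynomial ι ℂ :=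
  aeval fun t => ∑ k, C (b k t) * X k

lemma eval_linSubst {ι τ : Type*} [Fintype ι] (b : ι → τ → ℂ) (x : ι → ℂ) (P : MvPolynomial τ ℂ) :
    eval x (linSubst b P) = eval (fun t => ∑ k, x k * b k t) P := by
  have h : (aeval x).comp (linSubst b) = aeval (R := ℂ) fun t => ∑ k, x k * b k t := by
    apply MvPolynomial.algHom_ext
    intro t
    simp [linSubst, mul_comm]
  have := DFunLike.congr_fun h P
  rwa [AlgHom.comp_apply, aeval_eq_eval, aeval_eq_eval] at this

lemma eval_pderiv_linSubst {ι τ : Type*} [Fintype ι] [Fintype τ] (b : ι → τ → ℂ) (x : ι → ℂ)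
    (P : MvPolynomial τ ℂ) (k : ι) :
    eval x (pderiv k (linSubst b P)) =
      ∑ t, eval (fun t => ∑ k, x k * b k t) (pderiv t P) * b k t := by
  classical
  rw [linSubst, derivation_aeval, map_sum]
  refine Finset.sum_congr rfl fun t _ => ?_
  rw [← linSubst, smul_eq_mul, map_mul, eval_linSubst]
  simp [pderiv_X, Pi.single_apply]

/-! ### Contractions of one-forms with linear vector fields -/

/-- The contraction of `ω` with the linear vector field `x ↦ A x`. -/
def contr (ω : OneForm) : Matrix (Fin 3) (Fin 3) ℂ →ₗ[ℂ] MvPolynomial (Fin 3) ℂ where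
  toFun A := ∑ i, ω i * linDeriv A (X i)
  map_add' A B := by
    simp [linDeriv_X, add_mul, mul_add, Finset.sum_add_distrib]
  map_smul' c A := by
    simp [linDeriv_X, Finset.smul_sum, MvPolynomial.smul_eq_C_mul, Finset.mul_sum, mul_assoc,
      mul_left_comm]

lemma contr_apply (ω : OneForm) (A : Matrix (Fin 3) (Fin 3) ℂ) :
    contr ω A = ∑ i, ω i * linDeriv A (X i) := rfl

lemma eval_linDeriv_X (A : Matrix (Fin 3) (Fin 3) ℂ) (v : Fin 3 → ℂ) (i : Fin 3) :
    eval v (linDeriv A (X i)) = A.mulVec v i := by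
  simp [linDeriv_X, Matrix.mulVec, dotProduct]

lemma eval_contr (ω : OneForm) (A : Matrix (Fin 3) (Fin 3) ℂ) (v : Fin 3 → ℂ) :
    eval v (contr ω A) = ∑ i, eval v (ω i) * A.mulVec v i := by
  simp [contr_apply, eval_linDeriv_X]

lemma linDeriv_eq_sum (A : Matrix (Fin 3) (Fin 3) ℂ) (p : MvPolynomial (Fin 3) ℂ) :
    linDeriv A p = ∑ k, linDeriv A (X k) * pderiv k p := by
  have h := derivation_aeval (linDeriv A) (X : Fin 3 → MvPolynomial (Fin 3) ℂ) p
  rw [aeval_X_left_apply] at h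
  simpa only [aeval_X_left_apply, smul_eq_mul, mul_comm] using h

lemma linDeriv_linDeriv_X (A B : Matrix (Fin 3) (Fin 3) ℂ) (i : Fin 3) :
    linDeriv A (linDeriv B (X i)) = linDeriv (B * A) (X i) := by
  simp only [linDeriv_X, map_sum, Derivation.leibniz, derivation_C, smul_eq_mul,
    mul_zero, add_zero, Matrix.mul_apply, Finset.sum_mul, Finset.mul_sum, C_mul, mul_assoc]
  rw [Finset.sum_comm]

/-- The Lie derivative of a contraction is the contraction with the bracket of the fields plus the
contraction of `L_A ω`, which is zero here. The bracket of the linear fields of `A` and `B` has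
matrix `B A - A B`. -/
lemma linDeriv_contr {ω : OneForm} {A : Matrix (Fin 3) (Fin 3) ℂ} (hA : lieDeriv ω A = 0)
    (B : Matrix (Fin 3) (Fin 3) ℂ) : linDeriv A (contr ω B) = contr ω (B * A - A * B) := by
  have h : ∀ j, linDeriv A (ω j) = -∑ i, C (A i j) * ω i := fun j => by
    have := congrFun hA j
    rw [lieDeriv_apply, Pi.zero_apply] at this
    linear_combination this
  rw [map_sub, contr_apply, contr_apply, contr_apply]
  simp only [map_sum, Derivation.leibniz, smul_eq_mul, linDeriv_linDeriv_X, h,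
    Finset.sum_add_distrib, sub_eq_add_neg, ← Finset.sum_neg_distrib]
  congr 1
  simp only [← linDeriv_linDeriv_X B A, linDeriv_X A, map_sum, Derivation.leibniz, derivation_C,
    smul_eq_mul, mul_zero, add_zero, Finset.mul_sum, ← Finset.sum_neg_distrib]
  rw [Finset.sum_comm]
  refine Finset.sum_congr rfl fun i _ => Finset.sum_congr rfl fun j _ => ?_
  ring

/-- At a zero of the linear vector field `A` preserving `ω`, the contractions with the brackets
of `A` vanish. -/
lemma eval_contr_bracket {ω : OneForm} {A : Matrix (Fin 3) (Fin 3) ℂ} (hA : lieDeriv ω A = 0)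
    (B : Matrix (Fin 3) (Fin 3) ℂ) {v : Fin 3 → ℂ} (hv : A.mulVec v = 0) :
    eval v (contr ω (B * A - A * B)) = 0 := by
  rw [← linDeriv_contr hA, linDeriv_eq_sum, map_sum]
  refine Finset.sum_eq_zero fun k _ => ?_
  rw [map_mul, eval_linDeriv_X, hv, Pi.zero_apply, zero_mul]

/-! ### Cartan's formula, the Euler identity and tangent linear fields -/

section Euler

variable {N : ℕ} {ω : OneForm}

/-- Cartan's formula `ι_B dω = L_B ω - d(ι_B ω)` in coordinates. -/
lemma sum_linDeriv_mul_curl {B : Matrix (Fin 3) (Fin 3) ℂ} (hB : lieDeriv ω B = 0) (j : Fin 3) :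
    ∑ k, linDeriv B (X k) * (pderiv k (ω j) - pderiv j (ω k)) = -pderiv j (contr ω B) := by
  have h := congrFun hB j
  rw [lieDeriv_apply, Pi.zero_apply, linDeriv_eq_sum] at h
  have hd : ∀ k, pderiv j (linDeriv B (X k)) = C (B k j) := by
    intro k
    rw [linDeriv_X, map_sum, Finset.sum_eq_single j]
    · simp
    · intro l _ hl
      simp [pderiv_X_of_ne hl]
    · simp
  rw [contr_apply, map_sum]
  simp only [Derivation.leibniz, hd, smul_eq_mul, mul_sub, Finset.sum_sub_distrib,
    Finset.sum_add_distrib]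
  have hc : ∑ i, ω i * C (B i j) = ∑ i, C (B i j) * ω i :=
    Finset.sum_congr rfl fun i _ => mul_comm _ _
  linear_combination h + hc

/-- Cartan's formula for the radial field `R`: here `ι_R ω = 0` and `L_R ω = (N + 2) ω`, so `ω` can
be recovered from `dω`. -/
lemma sum_X_mul_curl (hω : ω ∈ eulerForms N) (j : Fin 3) :
    ∑ k, X k * (pderiv k (ω j) - pderiv j (ω k)) = C ((N : ℂ) + 2) * ω j := by
  have h1 := (hω.1 j).sum_X_mul_pderiv
  have h2 := congrArg (pderiv j) hω.2
  rw [map_zero, map_sum] at h2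
  simp only [Derivation.leibniz, smul_eq_mul, Finset.sum_add_distrib] at h2
  have h3 : ∑ i, ω i * pderiv j (X i : MvPolynomial (Fin 3) ℂ) = ω j := by
    rw [Finset.sum_eq_single j]
    · simp
    · intro l _ hl
      simp [pderiv_X_of_ne hl]
    · simp
  simp only [mul_sub, Finset.sum_sub_distrib]
  rw [h1]
  simp only [nsmul_eq_mul, Nat.cast_add, Nat.cast_one, C_add, map_natCast, map_ofNat]
  linear_combination h3 - h2

lemma lieDeriv_one (hω : ω ∈ eulerForms N) : lieDeriv ω 1 = ((N : ℂ) + 2) • ω := by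
  funext j
  have hX : ∀ k, linDeriv 1 (X k) = (X k : MvPolynomial (Fin 3) ℂ) := by
    intro k
    simp [linDeriv_X, Matrix.one_apply, apply_ite C]
  rw [lieDeriv_apply, linDeriv_eq_sum]
  simp only [hX]
  rw [(hω.1 j).sum_X_mul_pderiv]
  simp [Matrix.one_apply, apply_ite C, MvPolynomial.smul_eq_C_mul]
  rw [show (C 2 : MvPolynomial (Fin 3) ℂ) = 2 from map_ofNat C 2]
  ring

/-- The relation between the contractions with two linear vector fields preserving `ω`. -/
lemma contr_mul_pderiv_sub (hω : ω ∈ eulerForms N) {A B : Matrix (Fin 3) (Fin 3) ℂ}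
    (hA : lieDeriv ω A = 0) (hB : lieDeriv ω B = 0) (j : Fin 3) :
    contr ω A * pderiv j (contr ω B) - contr ω B * pderiv j (contr ω A) =
      contr ω (B * A - A * B) * ω j := by
  have hN : (C ((N : ℂ) + 2) : MvPolynomial (Fin 3) ℂ) ≠ 0 := by
    rw [Ne, C_eq_zero]
    exact_mod_cast (by omega : N + 2 ≠ 0)
  have hbr : ∑ j, linDeriv B (X j) * ∑ k, linDeriv A (X k) * (pderiv k (ω j) - pderiv j (ω k)) =
      contr ω (B * A - A * B) := by
    simp only [sum_linDeriv_mul_curl hA]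
    have := linDeriv_contr hB A
    rw [linDeriv_eq_sum] at this
    simp only [mul_neg, Finset.sum_neg_distrib, this]
    rw [← map_neg]
    congr 1
    abel
  have hcA : C ((N : ℂ) + 2) * contr ω A = ∑ i, (∑ k, X k * (pderiv k (ω i) - pderiv i (ω k))) *
      linDeriv A (X i) := by
    simp only [sum_X_mul_curl hω, contr_apply, Finset.mul_sum, mul_assoc]
  have hcB : C ((N : ℂ) + 2) * contr ω B = ∑ i, (∑ k, X k * (pderiv k (ω i) - pderiv i (ω k))) *
      linDeriv B (X i) := by
    simp only [sum_X_mul_curl hω, contr_apply, Finset.mul_sum, mul_assoc]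
  have hdA := sum_linDeriv_mul_curl hA j
  have hdB := sum_linDeriv_mul_curl hB j
  have hj := sum_X_mul_curl hω j
  -- After multiplication by `N + 2`, every term is expressed through `dω` contracted with the
  -- radial field, `A` and `B`. What remains is the contraction of these three fields into `dω ∧
  -- dω`, which is zero because it is a 4-form in three variables.
  refine mul_left_cancel₀ hN ?_
  have e1 : C ((N : ℂ) + 2) * (contr ω A * pderiv j (contr ω B) -
      contr ω B * pderiv j (contr ω A)) = (C ((N : ℂ) + 2) * contr ω A) * pderiv j (contr ω B) -
      (C ((N : ℂ) + 2) * contr ω B) * pderiv j (contr ω A) := by ring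
  have e2 : C ((N : ℂ) + 2) * (contr ω (B * A - A * B) * ω j) =
      contr ω (B * A - A * B) * (C ((N : ℂ) + 2) * ω j) := by ring
  rw [e1, e2, hcA, hcB, ← hj, ← hbr, ← neg_eq_iff_eq_neg.2 hdA, ← neg_eq_iff_eq_neg.2 hdB]
  simp only [Fin.sum_univ_three]
  fin_cases j <;> simp <;> ring

/-- If `ω` has coprime coefficients of degree at least `3`, then the only linear vector fields
tangent to its foliation are the multiples of the radial one. -/
lemma eq_smul_one_of_contr_eq_zero (hN : 2 ≤ N) (hω : ω ∈ eulerForms N)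
    (hco : ∀ d : MvPolynomial (Fin 3) ℂ, (∀ i, d ∣ ω i) → IsUnit d)
    {A : Matrix (Fin 3) (Fin 3) ℂ} (hA : contr ω A = 0) : ∃ c : ℂ, A = c • 1 := by
  by_contra hns
  set a : Fin 3 → MvPolynomial (Fin 3) ℂ := fun i => linDeriv A (X i) with ha
  -- The form `ω` annihilates both `X` and `AX`, hence is parallel to their cross product.
  set η : Fin 3 → MvPolynomial (Fin 3) ℂ := crossProduct (X : Fin 3 → MvPolynomial (Fin 3) ℂ) a
    with hη
  have hE : X 0 * ω 0 + X 1 * ω 1 + X 2 * ω 2 = 0 := by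
    have := hω.2
    rwa [Fin.sum_univ_three] at this
  have hA' : ω 0 * a 0 + ω 1 * a 1 + ω 2 * a 2 = 0 := by
    rwa [contr_apply, Fin.sum_univ_three] at hA
  have η0 : η 0 = X 1 * a 2 - X 2 * a 1 := by simp [hη, cross_apply]
  have η1 : η 1 = X 2 * a 0 - X 0 * a 2 := by simp [hη, cross_apply]
  have η2 : η 2 = X 0 * a 1 - X 1 * a 0 := by simp [hη, cross_apply]
  have hpar : ∀ i j, ω i * η j = ω j * η i := by
    have h01 : ω 0 * η 1 = ω 1 * η 0 := by
      rw [η0, η1]; linear_combination X 2 * hA' - a 2 * hE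
    have h02 : ω 0 * η 2 = ω 2 * η 0 := by
      rw [η0, η2]; linear_combination -X 1 * hA' + a 1 * hE
    have h12 : ω 1 * η 2 = ω 2 * η 1 := by
      rw [η1, η2]; linear_combination X 0 * hA' - a 0 * hE
    intro i j
    fin_cases i <;> fin_cases j <;> simp [h01, h02, h12]
  obtain ⟨j, hj⟩ : ∃ j, η j ≠ 0 := by
    by_contra! h0
    apply hns
    have key : ∀ v : Fin 3 → ℂ, crossProduct v (A.mulVec v) = 0 := by
      intro v
      have h := fun i => congrArg (eval v) (h0 i)
      have z0 := h 0
      have z1 := h 1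
      have z2 := h 2
      rw [η0] at z0
      rw [η1] at z1
      rw [η2] at z2
      simp only [map_sub, map_mul, eval_X, ha, eval_linDeriv_X, map_zero] at z0 z1 z2
      rw [cross_apply, z0, z1, z2]
      ext i
      fin_cases i <;> rfl
    -- Every vector is an eigenvector of `A`; the basis vectors make `A` diagonal, and the two sums
    -- equate its diagonal entries.
    have k0 := key ![1, 0, 0]
    have k1 := key ![0, 1, 0]
    have k2 := key ![0, 0, 1]
    have k3 := key ![1, 1, 0]
    have k4 := key ![0, 1, 1]
    simp [cross_apply, Matrix.mulVec, dotProduct, Fin.sum_univ_three] at k0 k1 k2 k3 k4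
    refine ⟨A 0 0, ?_⟩
    ext i j
    fin_cases i <;> fin_cases j <;> simp <;> grind
  have hωj : ω j ≠ 0 := by
    intro h0
    have hz : ∀ i, ω i = 0 := fun i => by
      have := hpar i j
      rw [h0, zero_mul] at this
      exact (mul_eq_zero.1 this).resolve_right hj
    exact not_isUnit_zero (hco 0 fun i => by rw [hz i])
  -- By parallelism `ω j` divides `η j * ω i` for every `i`, and the `ω i` have gcd one. The degrees
  -- `N + 1 ≥ 3` and `2` then conflict.
  have hdvd : ω j ∣ η j := by
    classical
    let _ : GCDMonoid (MvPolynomial (Fin 3) ℂ) := UniqueFactorizationMonoid.toGCDMonoid _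
    have hg : IsUnit (gcd (ω 0) (gcd (ω 1) (ω 2))) := by
      refine hco _ fun i => ?_
      fin_cases i
      · exact gcd_dvd_left _ _
      · exact (gcd_dvd_right _ _).trans (gcd_dvd_left _ _)
      · exact (gcd_dvd_right _ _).trans (gcd_dvd_right _ _)
    have hd : ∀ i, ω j ∣ η j * ω i := fun i => ⟨η i, by rw [mul_comm, hpar]⟩
    have h1 : ω j ∣ η j * gcd (ω 1) (ω 2) :=
      (dvd_gcd (hd 1) (hd 2)).trans (gcd_mul_left' _ _ _).dvd
    have h2 : ω j ∣ η j * gcd (ω 0) (gcd (ω 1) (ω 2)) :=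
      (dvd_gcd (hd 0) h1).trans (gcd_mul_left' _ _ _).dvd
    exact hg.dvd_mul_right.1 h2
  have hah : ∀ i, (a i).IsHomogeneous 1 := fun i => by
    rw [ha]
    simp only [linDeriv_X]
    exact IsHomogeneous.sum _ _ _ fun l _ => (isHomogeneous_X ℂ l).C_mul _
  have hηh : (η j).IsHomogeneous 2 := by
    have hX := fun i : Fin 3 => isHomogeneous_X ℂ i
    fin_cases j
    · simp only [Fin.zero_eta, η0]; exact ((hX 1).mul (hah 2)).sub ((hX 2).mul (hah 1))
    · simp only [Fin.mk_one, η1]; exact ((hX 2).mul (hah 0)).sub ((hX 0).mul (hah 2))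
    · simp only [Fin.reduceFinMk, η2]; exact ((hX 0).mul (hah 1)).sub ((hX 1).mul (hah 0))
  have hle := MvPolynomial.totalDegree_le_of_dvd_of_isDomain hdvd hj
  rw [(hω.1 j).totalDegree hωj, hηh.totalDegree hj] at hle
  omega

end Euler

/-! ### Vanishing Wronskians and proportionality -/

/-- Compare orders of vanishing at 0: if `K` vanishes to finite order `m > 0`, the left side
vanishes to order at least `m`, and the right side to order exactly `m - 1`. -/
lemma polynomial_eq_zero_of_wronskian {K G : Polynomial ℂ}
    (hW : K * Polynomial.derivative G = G * Polynomial.derivative K) (hG : G.eval 0 ≠ 0)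
    (hK : K.eval 0 = 0) : K = 0 := by
  have hGne : G ≠ 0 := fun h0 => hG (by rw [h0, Polynomial.eval_zero])
  by_contra hKne
  have hK' : Polynomial.derivative K ≠ 0 := by
    intro h0
    have := Polynomial.derivative_eq_zero.1 h0
    rw [Polynomial.natDegree_eq_zero] at this
    obtain ⟨d, hd⟩ := this
    rw [← hd, Polynomial.eval_C] at hK
    exact hKne (by rw [← hd, hK, Polynomial.C_0])
  have h1 : K * Polynomial.derivative G ≠ 0 := by rw [hW]; exact mul_ne_zero hGne hK'
  have h2 := congrArg (Polynomial.rootMultiplicity 0) hW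
  rw [Polynomial.rootMultiplicity_mul h1, Polynomial.rootMultiplicity_mul (hW ▸ h1),
    Polynomial.rootMultiplicity_eq_zero (p := G) hG,
    Polynomial.derivative_rootMultiplicity_of_root hK] at h2
  have h3 := (Polynomial.rootMultiplicity_pos hKne).2 hK
  omega

lemma eval_aeval_polynomial {ι : Type*} (y : ι → Polynomial ℂ) (t : ℂ) (p : MvPolynomial ι ℂ) :
    (aeval y p).eval t = eval (fun i => (y i).eval t) p := by
  induction p using MvPolynomial.induction_on with
  | C a => simp
  | add p q hp hq => simp only [map_add, Polynomial.eval_add, hp, hq]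
  | mul_X p i hp => simp only [map_mul, Polynomial.eval_mul, hp, aeval_X, eval_X]

lemma derivative_aeval_polynomial {ι : Type*} [Fintype ι] (y : ι → Polynomial ℂ)
    (p : MvPolynomial ι ℂ) : Polynomial.derivative (aeval y p) =
      ∑ i, aeval y (pderiv i p) * Polynomial.derivative (y i) :=
  derivation_aeval (Polynomial.derivative' (R := ℂ)) y p

/-- Two polynomials with zero Wronskians are proportional. -/
lemma exists_eq_smul_of_wronskian {ι : Type*} [Fintype ι] {f g : MvPolynomial ι ℂ} (hg : g ≠ 0)
    (h : ∀ j, f * pderiv j g = g * pderiv j f) : ∃ c : ℂ, f = c • g := by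
  obtain ⟨v, hv⟩ : ∃ v, eval v g ≠ 0 := by
    by_contra! h0
    exact hg (MvPolynomial.funext fun v => by rw [h0 v, map_zero])
  obtain ⟨c, hc⟩ : ∃ c, c = eval v f / eval v g := ⟨_, rfl⟩
  refine ⟨c, ?_⟩
  rw [← sub_eq_zero]
  obtain ⟨k, hk⟩ : ∃ k, k = f - c • g := ⟨_, rfl⟩
  have hkv : eval v k = 0 := by
    rw [hk, map_sub, smul_eval, hc, div_mul_cancel₀ _ hv, sub_self]
  have hw : ∀ j, k * pderiv j g = g * pderiv j k := by
    intro j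
    rw [hk, map_sub, Derivation.map_smul, sub_mul, mul_sub, h j, smul_mul_assoc, mul_smul_comm]
  rw [← hk]
  refine MvPolynomial.funext fun u => ?_
  rw [map_zero]
  -- Restriction to the line from `v` to `u` reduces to one variable; `c` was chosen so that `k = f
  -- - c g` vanishes at `v`, where `g` does not.
  obtain ⟨y, hy⟩ : ∃ y : ι → Polynomial ℂ,
      y = fun i => Polynomial.C (v i) + Polynomial.C (u i - v i) * Polynomial.X := ⟨_, rfl⟩
  have hy0 : (fun i => (y i).eval 0) = v := by simp [hy]
  have hy1 : (fun i => (y i).eval 1) = u := by simp [hy]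
  have hz : aeval y k = 0 := by
    refine polynomial_eq_zero_of_wronskian (G := aeval y g) ?_ ?_ ?_
    · rw [derivative_aeval_polynomial, derivative_aeval_polynomial, Finset.mul_sum, Finset.mul_sum]
      refine Finset.sum_congr rfl fun i _ => ?_
      rw [← mul_assoc, ← mul_assoc, ← map_mul, ← map_mul, hw]
    · rwa [eval_aeval_polynomial, hy0]
    · rwa [eval_aeval_polynomial, hy0]
  rw [← hy1, ← eval_aeval_polynomial, hz, Polynomial.eval_zero]

attribute [local instance] LieRing.ofAssociativeRing

/-! ### The Lie algebra of linear vector fields preserving a one-form -/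

lemma linDeriv_commutator (A B : Matrix (Fin 3) (Fin 3) ℂ) (p : MvPolynomial (Fin 3) ℂ) :
    linDeriv A (linDeriv B p) - linDeriv B (linDeriv A p) = linDeriv (B * A - A * B) p := by
  have h : ⁅linDeriv A, linDeriv B⁆ = linDeriv (B * A - A * B) := by
    apply derivation_ext
    intro k
    rw [Derivation.commutator_apply, linDeriv_linDeriv_X, linDeriv_linDeriv_X]
    simp [linDeriv_X, sub_mul]
  rw [← h, Derivation.commutator_apply]

lemma lieDeriv_commutator {ω : OneForm} {A B : Matrix (Fin 3) (Fin 3) ℂ} (hA : lieDeriv ω A = 0)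
    (hB : lieDeriv ω B = 0) : lieDeriv ω (A * B - B * A) = 0 := by
  have hA' : ∀ j, linDeriv A (ω j) = -∑ i, C (A i j) * ω i := fun j => by
    have := congrFun hA j
    rw [lieDeriv_apply, Pi.zero_apply] at this
    linear_combination this
  have hB' : ∀ j, linDeriv B (ω j) = -∑ i, C (B i j) * ω i := fun j => by
    have := congrFun hB j
    rw [lieDeriv_apply, Pi.zero_apply] at this
    linear_combination this
  funext j
  rw [lieDeriv_apply, ← linDeriv_commutator, hA', hB']
  have hD : ∀ (D : Matrix (Fin 3) (Fin 3) ℂ) (c : ℂ) (p : MvPolynomial (Fin 3) ℂ),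
      linDeriv D (C c * p) = C c * linDeriv D p := fun D c p => by
    rw [Derivation.leibniz, derivation_C, smul_zero, add_zero, smul_eq_mul]
  simp only [Fin.sum_univ_three, map_neg, map_add, hD, hA', hB', Matrix.sub_apply,
    Matrix.mul_apply, C_sub, C_mul, Pi.zero_apply]
  ring

/-- The Lie algebra of the linear vector fields preserving `ω`. -/
def symmetries (ω : OneForm) : LieSubalgebra ℂ (Matrix (Fin 3) (Fin 3) ℂ) where
  toSubmodule := LinearMap.ker (lieDeriv ω)
  lie_mem' hA hB := lieDeriv_commutator hA hB

lemma mem_symmetries {ω : OneForm} {A : Matrix (Fin 3) (Fin 3) ℂ} :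
    A ∈ symmetries ω ↔ lieDeriv ω A = 0 := Iff.rfl

section Centralizers

variable {N : ℕ} {ω : OneForm} (hN : 2 ≤ N) (hω : ω ∈ eulerForms N)
  (hco : ∀ d : MvPolynomial (Fin 3) ℂ, (∀ i, d ∣ ω i) → IsUnit d)
include hN hω hco

lemma eq_zero_of_contr_eq_zero {A : Matrix (Fin 3) (Fin 3) ℂ} (hA : A ∈ symmetries ω)
    (h : contr ω A = 0) : A = 0 := by
  obtain ⟨c, rfl⟩ := eq_smul_one_of_contr_eq_zero hN hω hco h
  rw [mem_symmetries, map_smul, lieDeriv_one hω, smul_smul, smul_eq_zero] at hA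
  rcases hA with hc | h0
  · have : (N : ℂ) + 2 ≠ 0 := by exact_mod_cast (by omega : N + 2 ≠ 0)
    rw [(mul_eq_zero.1 hc).resolve_right this, zero_smul]
  · exact absurd (hco 0 fun i => by rw [h0]; rfl) not_isUnit_zero

lemma exists_eq_smul_of_commute {A B : Matrix (Fin 3) (Fin 3) ℂ} (hA : A ∈ symmetries ω)
    (hB : B ∈ symmetries ω) (hB0 : B ≠ 0) (hAB : A * B = B * A) : ∃ c : ℂ, A = c • B := by
  have hfB : contr ω B ≠ 0 := fun h => hB0 (eq_zero_of_contr_eq_zero hN hω hco hB h)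
  obtain ⟨c, hc⟩ := exists_eq_smul_of_wronskian (f := contr ω A) hfB fun j => by
    have := contr_mul_pderiv_sub hω hA hB j
    rw [← hAB, sub_self, map_zero, zero_mul] at this
    exact sub_eq_zero.1 this
  refine ⟨c, sub_eq_zero.1 (eq_zero_of_contr_eq_zero hN hω hco
    ((symmetries ω).sub_mem hA ((symmetries ω).smul_mem c hB)) ?_)⟩
  rw [map_sub, map_smul, hc, sub_self]

end Centralizers

/-! ### Lie algebras of matrices with one-dimensional centralizers -/

lemma exists_hasEigenvalue_ne_zero {M : Type*} [AddCommGroup M] [Module ℂ M]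
    [FiniteDimensional ℂ M] {T : Module.End ℂ M} (hT : ¬ IsNilpotent T) :
    ∃ μ : ℂ, μ ≠ 0 ∧ T.HasEigenvalue μ := by
  by_contra! h
  apply hT
  rw [LinearMap.isNilpotent_iff_charpoly]
  have hs := IsAlgClosed.splits T.charpoly
  have hr : T.charpoly.roots = Multiset.replicate (Module.finrank ℂ M) 0 := by
    rw [Multiset.eq_replicate]
    refine ⟨?_, fun μ hμ => ?_⟩
    · rw [← LinearMap.charpoly_natDegree T]
      exact hs.natDegree_eq_card_roots.symm
    · by_contra h0
      exact h μ h0 ((Module.End.hasEigenvalue_iff_isRoot_charpoly _ _).2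
        (Polynomial.isRoot_of_mem_roots hμ))
  rw [hs.eq_prod_roots_of_monic T.charpoly_monic, hr]
  simp

/-- Otherwise the powers `E ^ k` would be eigenvectors of `ad A` with the infinitely many distinct
eigenvalues `k μ`. -/
lemma isNilpotent_of_commutator_eq_smul {n : Type*} [Fintype n] [DecidableEq n]
    {A E : Matrix n n ℂ} {μ : ℂ} (hμ : μ ≠ 0) (h : A * E - E * A = μ • E) : IsNilpotent E := by
  by_contra hE
  have hpow : ∀ k : ℕ, A * E ^ k - E ^ k * A = ((k : ℂ) * μ) • E ^ k := by
    intro k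
    induction k with
    | zero => simp
    | succ k ih =>
      have h1 : A * E ^ (k + 1) - E ^ (k + 1) * A =
          (A * E ^ k - E ^ k * A) * E + E ^ k * (A * E - E * A) := by
        rw [pow_succ]; noncomm_ring
      rw [h1, ih, h, smul_mul_assoc, mul_smul_comm, ← pow_succ, ← add_smul]
      congr 1
      push_cast
      ring
  let T : Module.End ℂ (Matrix n n ℂ) := LinearMap.mulLeft ℂ A - LinearMap.mulRight ℂ A
  have hev : ∀ k : ℕ, T.HasEigenvalue ((k : ℂ) * μ) := fun k =>
    Module.End.hasEigenvalue_of_hasEigenvector (x := E ^ k)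
      (Module.End.hasEigenvector_iff.2 ⟨Module.End.mem_eigenspace_iff.2 (hpow k),
        fun h0 => hE ⟨k, h0⟩⟩)
  have hinj : Function.Injective fun k : ℕ => (k : ℂ) * μ := fun a b hab => by
    have := mul_right_cancel₀ hμ hab
    exact_mod_cast this
  exact (Set.infinite_of_injective_forall_mem hinj hev) T.finite_hasEigenvalue

/-- A Lie algebra of matrices, of dimension at least three, in which commuting elements are
proportional contains an `sl₂`-triple with nilpotent `e`. -/
lemma exists_sl2_triple {n : Type*} [Fintype n] [DecidableEq n]
    (L : LieSubalgebra ℂ (Matrix n n ℂ)) (hdim : 3 ≤ Module.finrank ℂ L)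
    (hcomm : ∀ A ∈ L, ∀ B ∈ L, B ≠ 0 → A * B = B * A → ∃ c : ℂ, A = c • B) :
    ∃ h ∈ L, ∃ e ∈ L, ∃ f ∈ L, e ≠ 0 ∧ IsNilpotent e ∧ h * e - e * h = (2 : ℂ) • e ∧
      e * f - f * e = h ∧ h * f - f * h = -(2 : ℂ) • f := by
  have hLn : Nontrivial L := Module.nontrivial_of_finrank_pos (R := ℂ) (by omega)
  -- A nilpotent `L` would have a nonzero central element, to which every element would be
  -- proportional.
  have hnil : ¬ LieRing.IsNilpotent L := by
    intro hn
    have := LieAlgebra.non_trivial_center_of_isNilpotent (R := ℂ) (L := L)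
    obtain ⟨⟨z, hz⟩, hz0⟩ := exists_ne (0 : LieAlgebra.center ℂ L)
    have hzne : (z : Matrix n n ℂ) ≠ 0 := fun h0 => hz0 (by ext1; exact Subtype.ext h0)
    have hle : Module.finrank ℂ L ≤ 1 := by
      refine finrank_le_one z fun A => ?_
      have h1 : ⁅A, z⁆ = 0 := hz A
      have h2 : (A : Matrix n n ℂ) * z - z * A = 0 := congrArg Subtype.val h1
      obtain ⟨c, hc⟩ := hcomm A A.2 z z.2 hzne (sub_eq_zero.1 h2)
      exact ⟨c, Subtype.ext hc.symm⟩
    omega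
  -- By Engel's theorem some `ad A` is not nilpotent, so it has an eigenvector `e` with nonzero
  -- eigenvalue.
  rw [LieAlgebra.isNilpotent_iff_forall (R := ℂ)] at hnil
  push Not at hnil
  obtain ⟨A, hA⟩ := hnil
  obtain ⟨μ, hμ, hev⟩ := exists_hasEigenvalue_ne_zero hA
  obtain ⟨e, he, he0⟩ := hev.exists_hasEigenvector
  rw [Module.End.mem_eigenspace_iff] at he
  have hAe : (A : Matrix n n ℂ) * e - e * A = μ • (e : Matrix n n ℂ) := congrArg Subtype.val he
  have henil : IsNilpotent (e : Matrix n n ℂ) := isNilpotent_of_commutator_eq_smul hμ hAe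
  have hene : (e : Matrix n n ℂ) ≠ 0 := fun h0 => he0 (Subtype.ext h0)
  set T : Module.End ℂ L := LieAlgebra.ad ℂ L e with hT
  have hTnil : IsNilpotent T := LieAlgebra.isNilpotent_ad_of_isNilpotent henil
  have hker : ∀ x : L, T x = 0 → ∃ c : ℂ, x = c • e := by
    intro x hx
    have h2 : (e : Matrix n n ℂ) * x - x * e = 0 := congrArg Subtype.val hx
    obtain ⟨c, hc⟩ := hcomm x x.2 e e.2 hene (sub_eq_zero.1 h2).symm
    exact ⟨c, Subtype.ext hc⟩
  have hkerdim : Module.finrank ℂ (LinearMap.ker T) ≤ 1 := by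
    have hsub : LinearMap.ker T ≤ Submodule.span ℂ {e} := fun x hx => by
      obtain ⟨c, rfl⟩ := hker x hx
      exact Submodule.smul_mem _ _ (Submodule.mem_span_singleton_self e)
    exact (Submodule.finrank_mono hsub).trans (finrank_span_singleton he0).le
  -- If `T ^ 2 = 0`, rank-nullity with a kernel of dimension at most one would force `dim L ≤ 2`.
  have hT2 : T ^ 2 ≠ 0 := by
    intro h0
    have hle : LinearMap.range T ≤ LinearMap.ker T := by
      rintro _ ⟨x, rfl⟩
      have := LinearMap.congr_fun h0 x
      rwa [pow_two] at this
    have h1 := Submodule.finrank_mono hle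
    have h2 := LinearMap.finrank_range_add_finrank_ker T
    omega
  -- The last nonzero power of the nilpotent `T` is at least the second and takes values in the
  -- kernel, the line of `e`; so `e` is, up to a scalar, in the image of `T ^ 2`.
  obtain ⟨y, c, hc, hy⟩ : ∃ (y : L) (c : ℂ), c ≠ 0 ∧ T (T y) = c • e := by
    obtain ⟨m, hm⟩ := hTnil
    have hex : ∃ k, T ^ k = 0 := ⟨m, hm⟩
    classical
    have hk := Nat.find_spec hex
    have hk2 : 2 < Nat.find hex := by
      by_contra hlt
      exact hT2 (pow_eq_zero_of_le (not_lt.1 hlt) hk)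
    obtain ⟨k, hkeq⟩ : ∃ k, Nat.find hex = k + 3 := ⟨Nat.find hex - 3, by omega⟩
    have hlow : T ^ (k + 2) ≠ 0 := Nat.find_min hex (by omega)
    obtain ⟨x, hx⟩ : ∃ x, (T ^ (k + 2)) x ≠ 0 := by
      by_contra! hall
      exact hlow (LinearMap.ext hall)
    have hTx : T ((T ^ (k + 2)) x) = 0 := by
      have := LinearMap.congr_fun hk x
      rwa [hkeq, pow_succ'] at this
    obtain ⟨c, hc⟩ := hker _ hTx
    refine ⟨(T ^ k) x, c, fun h0 => hx (by rw [hc, h0, zero_smul]), ?_⟩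
    rw [← hc, add_comm, pow_add, pow_two]
    rfl
  -- The scaling gives `[e, [e, F]] = -2 e`, that is `[h, e] = 2 e` for `h = [e, F]`.
  set F : L := (-2 / c) • y with hF
  have hTF : T (T F) = (-2 : ℂ) • e := by
    rw [hF, map_smul, map_smul, hy, smul_smul, div_mul_cancel₀ _ hc]
  set h : L := T F with hh
  have hhe : (h : Matrix n n ℂ) * e - e * h = (2 : ℂ) • (e : Matrix n n ℂ) := by
    have h1 : (e : Matrix n n ℂ) * h - h * e = (-2 : ℂ) • (e : Matrix n n ℂ) :=
      congrArg Subtype.val hTF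
    rw [← neg_sub, h1, neg_smul, neg_neg]
  have hef : (e : Matrix n n ℂ) * F - F * e = h := rfl
  -- The Jacobi identity shows that `[h, F] + 2 F` commutes with `e`, so it equals `d e`. Replacing
  -- `F` by `F - (d / 4) e` removes this error and leaves `[e, F]` unchanged.
  obtain ⟨d, hd⟩ := hker (⁅h, F⁆ + (2 : ℂ) • F) (Subtype.ext (by
    change (e : Matrix n n ℂ) * ((h : Matrix n n ℂ) * F - F * h + (2 : ℂ) • (F : Matrix n n ℂ)) -
      ((h : Matrix n n ℂ) * F - F * h + (2 : ℂ) • (F : Matrix n n ℂ)) * e = 0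
    have h3 : (e : Matrix n n ℂ) * ((h : Matrix n n ℂ) * F - F * h +
        (2 : ℂ) • (F : Matrix n n ℂ)) - ((h : Matrix n n ℂ) * F - F * h +
        (2 : ℂ) • (F : Matrix n n ℂ)) * e =
        -(((h : Matrix n n ℂ) * e - e * h) * F - F * ((h : Matrix n n ℂ) * e - e * h)) +
        ((h : Matrix n n ℂ) * ((e : Matrix n n ℂ) * F - F * e) -
          ((e : Matrix n n ℂ) * F - F * e) * h) +
        (2 : ℂ) • ((e : Matrix n n ℂ) * F - F * e) := by
      rw [mul_add, add_mul, mul_smul_comm, smul_mul_assoc, smul_sub]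
      noncomm_ring
    rw [h3, hhe, hef, smul_mul_assoc, mul_smul_comm, ← smul_sub, hef]
    simp))
  have hhF : (h : Matrix n n ℂ) * F - F * h + (2 : ℂ) • (F : Matrix n n ℂ) =
      d • (e : Matrix n n ℂ) := congrArg Subtype.val hd
  refine ⟨h, h.2, e, e.2, (F : Matrix n n ℂ) - (d / 4) • (e : Matrix n n ℂ),
    L.sub_mem F.2 (L.smul_mem _ e.2), hene, henil, hhe, ?_, ?_⟩
  · rw [mul_sub, sub_mul, mul_smul_comm, smul_mul_assoc, ← hef]
    abel
  · have h4 : (h : Matrix n n ℂ) * F - F * h = d • (e : Matrix n n ℂ) -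
        (2 : ℂ) • (F : Matrix n n ℂ) := eq_sub_of_add_eq hhF
    have h5 : (h : Matrix n n ℂ) * (F - (d / 4) • (e : Matrix n n ℂ)) -
        (F - (d / 4) • (e : Matrix n n ℂ)) * h = ((h : Matrix n n ℂ) * F - F * h) -
        (d / 4) • ((h : Matrix n n ℂ) * e - e * h) := by
      rw [mul_sub, sub_mul, mul_smul_comm, smul_mul_assoc, smul_sub]
      abel
    rw [h5, h4, hhe]
    module

/-! ### The Lie algebra of symmetries contains no `sl₂`-triple -/

/-- A linear functional, as a linear form. -/
def linForm (l : (Fin 3 → ℂ) →ₗ[ℂ] ℂ) : MvPolynomial (Fin 3) ℂ :=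
  ∑ j, C (l (Pi.single j 1)) * X j

lemma eval_linForm (l : (Fin 3 → ℂ) →ₗ[ℂ] ℂ) (v : Fin 3 → ℂ) : eval v (linForm l) = l v := by
  conv_rhs => rw [pi_eq_sum_univ' v]
  simp only [linForm, map_sum, map_mul, eval_C, eval_X, map_smul, smul_eq_mul]
  exact Finset.sum_congr rfl fun j _ => mul_comm _ _

/-- The value at `v` of the contraction with a vector `w`. -/
def formAt (ω : OneForm) (v : Fin 3 → ℂ) : (Fin 3 → ℂ) →ₗ[ℂ] ℂ :=
  ∑ i, eval v (ω i) • LinearMap.proj i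

lemma eval_contr_eq (ω : OneForm) (A : Matrix (Fin 3) (Fin 3) ℂ) (v : Fin 3 → ℂ) :
    eval v (contr ω A) = formAt ω v (A.mulVec v) := by
  rw [eval_contr]
  simp [formAt]

section Triples

variable {N : ℕ} {ω : OneForm} (hN : 2 ≤ N) (hω : ω ∈ eulerForms N)
  (hco : ∀ d : MvPolynomial (Fin 3) ℂ, (∀ i, d ∣ ω i) → IsUnit d)
  {h e f : Matrix (Fin 3) (Fin 3) ℂ} (hh : h ∈ symmetries ω) (he : e ∈ symmetries ω)
  (hf : f ∈ symmetries ω) (he0 : e ≠ 0) (hhe : h * e - e * h = (2 : ℂ) • e)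
  (hef : e * f - f * e = h) (hhf : h * f - f * h = -(2 : ℂ) • f)

/-- The image lies in the kernel, and the two dimensions add up to 3, so the rank is at most one. -/
lemma exists_rank_one {e : Matrix (Fin 3) (Fin 3) ℂ} (he0 : e ≠ 0) (he2 : e * e = 0) :
    ∃ (u : Fin 3 → ℂ) (φ : (Fin 3 → ℂ) →ₗ[ℂ] ℂ), φ ≠ 0 ∧ ∀ v, e.mulVec v = φ v • u := by
  set T := Matrix.mulVecLin e with hT
  have hle : LinearMap.range T ≤ LinearMap.ker T := by
    rintro _ ⟨x, rfl⟩
    rw [LinearMap.mem_ker, hT, Matrix.mulVecLin_apply, Matrix.mulVecLin_apply,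
      Matrix.mulVec_mulVec, he2, Matrix.zero_mulVec]
  have h1 := Submodule.finrank_mono hle
  have h2 := LinearMap.finrank_range_add_finrank_ker T
  rw [Module.finrank_fin_fun] at h2
  obtain ⟨⟨u, hu⟩, hspan⟩ := finrank_le_one_iff.1
    (by omega : Module.finrank ℂ (LinearMap.range T) ≤ 1)
  have hspan' : ∀ v, ∃ c : ℂ, e.mulVec v = c • u := fun v => by
    obtain ⟨c, hc⟩ := hspan ⟨T v, v, rfl⟩
    exact ⟨c, (congrArg Subtype.val hc).symm⟩
  have hu0 : u ≠ 0 := by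
    rintro rfl
    apply he0
    apply Matrix.ext_of_mulVec_single
    intro i
    obtain ⟨c, hc⟩ := hspan' (Pi.single i 1)
    rw [hc, smul_zero, Matrix.zero_mulVec]
  obtain ⟨i, hi⟩ := Function.ne_iff.1 hu0
  rw [Pi.zero_apply] at hi
  refine ⟨u, (u i)⁻¹ • (LinearMap.proj i).comp T, ?_, ?_⟩
  · intro h0
    apply he0
    apply Matrix.ext_of_mulVec_single
    intro k
    obtain ⟨c, hc⟩ := hspan' (Pi.single k 1)
    have h3 := LinearMap.congr_fun h0 (Pi.single k 1)
    simp only [LinearMap.smul_apply, LinearMap.comp_apply, LinearMap.proj_apply, hT,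
      Matrix.mulVecLin_apply, hc, Pi.smul_apply, smul_eq_mul, LinearMap.zero_apply] at h3
    rcases mul_eq_zero.1 h3 with h4 | h4
    · exact absurd h4 (inv_ne_zero hi)
    · rw [hc, (mul_eq_zero.1 h4).resolve_right hi, zero_smul, Matrix.zero_mulVec]
  · intro v
    obtain ⟨c, hc⟩ := hspan' v
    simp only [LinearMap.smul_apply, LinearMap.comp_apply, LinearMap.proj_apply, hT,
      Matrix.mulVecLin_apply, hc, Pi.smul_apply, smul_eq_mul]
    congr 1
    field_simp

include hhe hef in
lemma mul_mul_eq_of_sq_eq_zero (he2 : e * e = 0) : e * f * e = e := by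
  have h1 : h * e - e * h = (2 : ℂ) • (e * f * e) := by
    have : h * e - e * h = 2 * (e * f * e) - f * (e * e) - (e * e) * f := by
      rw [← hef]; noncomm_ring
    rw [this, he2, two_smul]
    noncomm_ring
  rw [h1] at hhe
  exact smul_right_injective _ (two_ne_zero (α := ℂ)) hhe

-- Put `g = f - f e f`. Then `e g = g e = 0`, and `[h, g] = -2 g` becomes `(e f) g + g (f e) = -2
-- g`. As `e f` and `f e` are idempotent, left multiplication by the first and right multiplication
-- by the second are commuting projections; their sum has eigenvalues among 0, 1, 2, so `g = 0`.
include hhe hef hhf in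
lemma mul_mul_eq_of_sq_eq_zero' (he2 : e * e = 0) : f * e * f = f := by
  have h1 := mul_mul_eq_of_sq_eq_zero hhe hef he2
  obtain ⟨g, hg⟩ : ∃ g, g = f - f * e * f := ⟨_, rfl⟩
  have heg : e * g = 0 := by
    have : e * g = e * f - (e * f * e) * f := by rw [hg]; noncomm_ring
    rw [this, h1, sub_self]
  have hge : g * e = 0 := by
    have : g * e = f * e - f * (e * f * e) := by rw [hg]; noncomm_ring
    rw [this, h1, sub_self]
  have h2 : e * f * g + g * f * e = -(2 : ℂ) • g := by
    have e1 : h * g - g * h = (h * f - f * h) - ((h * f - f * h) * e * f +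
        f * (h * e - e * h) * f + f * e * (h * f - f * h)) := by
      rw [hg]; noncomm_ring
    have e2 : h * g - g * h = e * f * g + g * f * e - f * (e * g) - (g * e) * f := by
      rw [← hef]; noncomm_ring
    rw [e1, hhf, hhe, heg, hge] at e2
    rw [mul_zero, zero_mul, sub_zero, sub_zero] at e2
    rw [← e2, hg]
    simp only [smul_mul_assoc, mul_smul_comm, smul_sub]
    module
  have hc : e * f * g * f * e = 0 := by
    have e1 : e * f * (e * f * g + g * f * e) * (f * e) =
        (e * f * e) * f * g * f * e + e * f * g * f * (e * f * e) := by noncomm_ring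
    rw [h2, h1] at e1
    have e2 : e * f * (-(2 : ℂ) • g) * (f * e) = -(2 : ℂ) • (e * f * g * f * e) := by
      rw [mul_smul_comm, smul_mul_assoc]
      congr 1
      noncomm_ring
    rw [e2] at e1
    have e3 : (4 : ℂ) • (e * f * g * f * e) = 0 := by
      linear_combination (norm := module) -e1
    exact (smul_eq_zero.1 e3).resolve_left (by norm_num)
  have ha : e * f * g = 0 := by
    have e1 : e * f * (e * f * g + g * f * e) = (e * f * e) * f * g + e * f * g * f * e := by
      noncomm_ring
    rw [h2, h1, hc, mul_smul_comm] at e1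
    have e3 : (3 : ℂ) • (e * f * g) = 0 := by
      linear_combination (norm := module) -e1
    exact (smul_eq_zero.1 e3).resolve_left (by norm_num)
  have hb : g * f * e = 0 := by
    have e1 : (e * f * g + g * f * e) * (f * e) = e * f * g * f * e + g * f * (e * f * e) := by
      noncomm_ring
    rw [h2, h1, hc, smul_mul_assoc, ← mul_assoc] at e1
    have e3 : (3 : ℂ) • (g * f * e) = 0 := by
      linear_combination (norm := module) -e1
    exact (smul_eq_zero.1 e3).resolve_left (by norm_num)
  rw [ha, hb, add_zero, eq_comm, smul_eq_zero] at h2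
  have h3 := h2.resolve_left (by norm_num)
  rw [hg, sub_eq_zero] at h3
  exact h3.symm

-- Here `ℂ³` is the standard representation plus a trivial one, and `e f + f e` is the projection
-- onto the standard plane. Invariance of `ω` under the elements of `sl₂` vanishing at each vector
-- makes this projection tangent to the foliation, hence scalar, although it has a kernel.
include hN hω hco hh he hf he0 hhe hef hhf in
lemma not_sl2_triple_of_sq_eq_zero (he2 : e * e = 0) : False := by
  have h1 := mul_mul_eq_of_sq_eq_zero hhe hef he2
  have h2 := mul_mul_eq_of_sq_eq_zero' hhe hef hhf he2
  obtain ⟨u, φ, hφ, hev⟩ := exists_rank_one he0 he2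
  have hfv : ∀ v, f.mulVec v = φ (f.mulVec v) • f.mulVec u := fun v => by
    conv_lhs => rw [← h2, mul_assoc, ← Matrix.mulVec_mulVec, ← Matrix.mulVec_mulVec, hev,
      Matrix.mulVec_smul]
  have hefv : ∀ v, (e * f).mulVec v = φ (f.mulVec v) • u := fun v => by
    rw [← Matrix.mulVec_mulVec, hev]
  have hfev : ∀ v, (f * e).mulVec v = φ v • f.mulVec u := fun v => by
    rw [← Matrix.mulVec_mulVec, hev, Matrix.mulVec_smul]
  have hkey : linForm φ * linForm φ * contr ω (e * f + f * e) = 0 := by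
    refine MvPolynomial.funext fun v => ?_
    obtain ⟨x, hx⟩ : ∃ x, x = φ (f.mulVec v) := ⟨_, rfl⟩
    obtain ⟨y, hy⟩ : ∃ y, y = φ v := ⟨_, rfl⟩
    have hhv : h.mulVec v = x • u - y • f.mulVec u := by
      rw [← hef, Matrix.sub_mulVec, hefv, hfev, hx, hy]
    -- With `x`, `y` the coordinates of `v` along `u` and `f u`, this combination kills `v`. Its
    -- bracket with `e`, contracted at `v`, gives `-y² ω((e f + f e) v) = 0`.
    have hA := (symmetries ω).add_mem ((symmetries ω).sub_mem ((symmetries ω).smul_mem (x * y) hh)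
      ((symmetries ω).smul_mem (x * x) he)) ((symmetries ω).smul_mem (y * y) hf)
    have hAv : ((x * y) • h - (x * x) • e + (y * y) • f).mulVec v = 0 := by
      rw [Matrix.add_mulVec, Matrix.sub_mulVec, Matrix.smul_mulVec, Matrix.smul_mulVec,
        Matrix.smul_mulVec, hhv, hev, hfv v, ← hx, ← hy]
      module
    have hb := eval_contr_bracket hA e hAv
    have hbr : e * ((x * y) • h - (x * x) • e + (y * y) • f) -
        ((x * y) • h - (x * x) • e + (y * y) • f) * e =
        (y * y) • (e * f - f * e) - (x * y) • (h * e - e * h) := by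
      simp only [mul_add, mul_sub, add_mul, sub_mul, mul_smul_comm, smul_mul_assoc]
      module
    rw [hbr, hef, hhe, eval_contr_eq, Matrix.sub_mulVec, Matrix.smul_mulVec, Matrix.smul_mulVec,
      Matrix.smul_mulVec, hhv, hev, ← hy] at hb
    simp only [map_sub, map_smul, smul_eq_mul] at hb
    rw [map_mul, map_mul, eval_linForm, eval_contr_eq, Matrix.add_mulVec, hefv, hfev, ← hx, ← hy]
    simp only [map_add, map_smul, smul_eq_mul, map_zero]
    linear_combination -hb
  have hφ' : linForm φ ≠ 0 := fun h0 => hφ (LinearMap.ext fun v => by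
    rw [← eval_linForm, h0, map_zero, LinearMap.zero_apply])
  obtain ⟨c, hc⟩ := eq_smul_one_of_contr_eq_zero hN hω hco
    ((mul_eq_zero.1 hkey).resolve_left (mul_ne_zero hφ' hφ'))
  have hc0 : c = 1 := by
    have e1 : e * (e * f + f * e) = c • e := by rw [hc, mul_smul_comm, mul_one]
    have e2 : e * (e * f + f * e) = (e * e) * f + e * f * e := by noncomm_ring
    rw [e2, he2, h1, zero_mul, zero_add] at e1
    have e3 : (c - 1) • e = 0 := by rw [sub_smul, ← e1, one_smul, sub_self]
    exact sub_eq_zero.1 ((smul_eq_zero.1 e3).resolve_right he0)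
  -- Two linear forms on `ℂ³` have a common nonzero zero, which `e f + f e = 1` would send to 0.
  have hker := LinearMap.ker_ne_bot_of_finrank_lt (f := φ.prod (φ.comp f.mulVecLin)) (by simp)
  obtain ⟨v, hv, hv0⟩ := (Submodule.ne_bot_iff _).1 hker
  have hv := Prod.mk_eq_zero.1 (LinearMap.mem_ker.1 hv)
  apply hv0
  have hv2 : φ (f.mulVec v) = 0 := hv.2
  have := congrArg (fun M => M.mulVec v) hc
  simp only [hc0, one_smul, Matrix.one_mulVec, Matrix.add_mulVec, hefv, hfev, hv.1, hv2,
    zero_smul, add_zero] at this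
  exact this.symm

-- Here `ℂ³` is the irreducible representation with weights 2, 0, -2. Away from the invariant conic
-- `y² = 2 x z`, the symmetry vanishing at `v` forces the contraction with `e` to vanish at `v`, so
-- `e` is tangent to the foliation and must be zero.
include hN hω hco hh he hf he0 hhe hef hhf in
lemma not_sl2_triple_of_sq_ne_zero (he2 : e * e ≠ 0) (he3 : e * e * e = 0) : False := by
  have hhe2 : h * (e * e) = (2 : ℂ) • (e * e) := by
    -- The commutator of `e³ = 0` with `f`. Together with `h e = e h + 2 e` it shows that the image
    -- of `e²` has weight 2, which provides the highest weight vector `u`.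
    have e1 : h * (e * e) + e * h * e + e * e * h = 0 := by
      have : (e * e * e) * f - f * (e * e * e) = (e * f - f * e) * e * e +
        e * (e * f - f * e) * e + e * e * (e * f - f * e) := by noncomm_ring
      rw [he3, zero_mul, mul_zero, sub_zero, hef] at this
      rw [this, ← mul_assoc]
    have e2 : h * (e * e) - e * h * e = (2 : ℂ) • (e * e) := by
      rw [← smul_mul_assoc, ← hhe]; noncomm_ring
    have e3 : e * h * e - e * e * h = (2 : ℂ) • (e * e) := by
      rw [← mul_smul_comm, ← hhe]; noncomm_ring
    linear_combination (norm := module) (1 / 3 : ℂ) • (e1 + (2 : ℂ) • e2 + e3)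
  obtain ⟨w, hw⟩ : ∃ w, (e * e).mulVec w ≠ 0 := by
    by_contra! h0
    exact he2 (Matrix.ext_of_mulVec_single fun i => by rw [h0, Matrix.zero_mulVec])
  obtain ⟨u, hu⟩ : ∃ u, u = (e * e).mulVec w := ⟨_, rfl⟩
  rw [← hu] at hw
  have heu : e.mulVec u = 0 := by
    rw [hu, Matrix.mulVec_mulVec, ← mul_assoc, he3, Matrix.zero_mulVec]
  have hhu : h.mulVec u = (2 : ℂ) • u := by
    rw [hu, Matrix.mulVec_mulVec, hhe2, Matrix.smul_mulVec]
  have hefv : ∀ v, e.mulVec (f.mulVec v) = f.mulVec (e.mulVec v) + h.mulVec v := fun v => by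
    rw [← hef, Matrix.sub_mulVec, Matrix.mulVec_mulVec, Matrix.mulVec_mulVec]
    abel
  have hhfv : ∀ v, h.mulVec (f.mulVec v) = f.mulVec (h.mulVec v) - (2 : ℂ) • f.mulVec v :=
    fun v => by
      have := congrArg (fun M => M.mulVec v) hhf
      simp only [Matrix.sub_mulVec, Matrix.smul_mulVec, ← Matrix.mulVec_mulVec] at this
      linear_combination (norm := module) this
  obtain ⟨a, ha⟩ : ∃ a, a = f.mulVec u := ⟨_, rfl⟩
  have hea : e.mulVec a = (2 : ℂ) • u := by rw [ha, hefv, heu, hhu, Matrix.mulVec_zero, zero_add]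
  have hha : h.mulVec a = 0 := by
    rw [ha, hhfv, hhu, Matrix.mulVec_smul, sub_self]
  obtain ⟨b, hb⟩ : ∃ b, b = f.mulVec a := ⟨_, rfl⟩
  have heb : e.mulVec b = (2 : ℂ) • a := by
    rw [hb, hefv, hea, hha, Matrix.mulVec_smul, ← ha, add_zero]
  have hhb : h.mulVec b = -(2 : ℂ) • b := by
    rw [hb, hhfv, hha, Matrix.mulVec_zero, zero_sub, neg_smul]
  have hli : LinearIndependent ℂ ![u, a, b] := by
    rw [Fintype.linearIndependent_iff]
    intro g hg
    simp only [Fin.sum_univ_three, Matrix.cons_val_zero, Matrix.cons_val_one,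
      Matrix.cons_val_two, Matrix.head_cons, Matrix.tail_cons] at hg
    have g1 := congrArg e.mulVec hg
    simp only [Matrix.mulVec_add, Matrix.mulVec_smul, heu, hea, heb, Matrix.mulVec_zero] at g1
    have g2 := congrArg e.mulVec g1
    simp only [Matrix.mulVec_add, Matrix.mulVec_smul, heu, hea, Matrix.mulVec_zero] at g2
    have z2 : g 2 = 0 := by
      have : (4 * g 2) • u = 0 := by linear_combination (norm := module) g2
      simpa [hw] using this
    have z1 : g 1 = 0 := by
      have : (2 * g 1) • u = 0 := by
        rw [z2] at g1
        linear_combination (norm := module) g1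
      simpa [hw] using this
    have z0 : g 0 = 0 := by
      have : (g 0) • u = 0 := by
        rw [z1, z2] at hg
        linear_combination (norm := module) hg
      simpa [hw] using this
    intro i
    fin_cases i
    exacts [z0, z1, z2]
  set B := basisOfLinearIndependentOfCardEqFinrank hli (by simp) with hB
  have hBv : ∀ v, v = B.repr v 0 • u + B.repr v 1 • a + B.repr v 2 • b := fun v => by
    conv_lhs => rw [← B.sum_repr v, Fin.sum_univ_three]
    simp [hB]
  -- The vector `f b` has weight -4, while the only weights are 2, 0, -2.
  have hfb : f.mulVec b = 0 := by
    have g1 := hBv (f.mulVec b)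
    have g2 := congrArg h.mulVec g1
    rw [hhfv, hhb] at g2
    simp only [Matrix.mulVec_add, Matrix.mulVec_smul, hhu, hha, hhb] at g2
    have g3 : (6 * B.repr (f.mulVec b) 0) • u + (4 * B.repr (f.mulVec b) 1) • a +
        (2 * B.repr (f.mulVec b) 2) • b = 0 := by
      linear_combination (norm := module) (-1 : ℂ) • g2 - (4 : ℂ) • g1
    have g4 := Fintype.linearIndependent_iff.1 hli ![6 * B.repr (f.mulVec b) 0,
      4 * B.repr (f.mulVec b) 1, 2 * B.repr (f.mulVec b) 2] (by
        simpa [Fin.sum_univ_three] using g3)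
    have z0 := g4 0
    have z1 := g4 1
    have z2 := g4 2
    simp at z0 z1 z2
    rw [g1, z0, z1, z2]
    simp
  have hkey : (linForm (B.coord 1) * linForm (B.coord 1) -
      C 2 * linForm (B.coord 0) * linForm (B.coord 2)) * contr ω e = 0 := by
    refine MvPolynomial.funext fun v => ?_
    obtain ⟨x, hx⟩ : ∃ x, x = B.repr v 0 := ⟨_, rfl⟩
    obtain ⟨y, hy⟩ : ∃ y, y = B.repr v 1 := ⟨_, rfl⟩
    obtain ⟨z, hz⟩ : ∃ z, z = B.repr v 2 := ⟨_, rfl⟩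
    have hv := hBv v
    rw [← hx, ← hy, ← hz] at hv
    have hhv : h.mulVec v = (2 * x) • u - (2 * z) • b := by
      rw [hv]
      simp only [Matrix.mulVec_add, Matrix.mulVec_smul, hhu, hha, hhb]
      module
    have hev : e.mulVec v = (2 * y) • u + (2 * z) • a := by
      rw [hv]
      simp only [Matrix.mulVec_add, Matrix.mulVec_smul, heu, hea, heb]
      module
    have hfv : f.mulVec v = x • a + y • b := by
      rw [hv]
      simp only [Matrix.mulVec_add, Matrix.mulVec_smul, ← ha, ← hb, hfb]
      module
    -- The symmetry `y h - x e + 2 z f` vanishes at `v = x u + y a + z b`. Its brackets with `e` and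
    -- `h`, and the field itself, give three linear relations between the values of `ω` on `e v`, `h
    -- v`, `f v`; eliminating the last two leaves `(y² - 2 x z) ω(e v) = 0`.
    have hA := (symmetries ω).add_mem ((symmetries ω).sub_mem ((symmetries ω).smul_mem y hh)
      ((symmetries ω).smul_mem x he)) ((symmetries ω).smul_mem (2 * z) hf)
    have hAv : (y • h - x • e + (2 * z) • f).mulVec v = 0 := by
      rw [Matrix.add_mulVec, Matrix.sub_mulVec, Matrix.smul_mulVec, Matrix.smul_mulVec,
        Matrix.smul_mulVec, hhv, hev, hfv]
      module
    have hb1 := eval_contr_bracket hA e hAv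
    have hbr1 : e * (y • h - x • e + (2 * z) • f) - (y • h - x • e + (2 * z) • f) * e =
        (2 * z) • (e * f - f * e) - y • (h * e - e * h) := by
      simp only [mul_add, mul_sub, add_mul, sub_mul, mul_smul_comm, smul_mul_assoc]
      module
    have hAv' := congrArg (formAt ω v) hAv
    rw [Matrix.add_mulVec, Matrix.sub_mulVec, Matrix.smul_mulVec, Matrix.smul_mulVec,
        Matrix.smul_mulVec] at hAv'
    have hb2 := eval_contr_bracket hA h hAv
    have hbr2 : h * (y • h - x • e + (2 * z) • f) - (y • h - x • e + (2 * z) • f) * h =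
        (2 * z) • (h * f - f * h) - x • (h * e - e * h) := by
      simp only [mul_add, mul_sub, add_mul, sub_mul, mul_smul_comm, smul_mul_assoc]
      module
    rw [hbr1, hef, hhe, eval_contr_eq, Matrix.sub_mulVec, Matrix.smul_mulVec, Matrix.smul_mulVec,
      Matrix.smul_mulVec] at hb1
    rw [hbr2, hhf, hhe, eval_contr_eq, Matrix.sub_mulVec, Matrix.smul_mulVec, Matrix.smul_mulVec,
      Matrix.smul_mulVec, Matrix.smul_mulVec] at hb2
    simp only [map_add, map_sub, map_smul, smul_eq_mul, map_zero] at hb1 hb2 hAv'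
    simp only [map_sub, map_mul, eval_linForm, eval_C, eval_contr_eq, map_zero,
      Module.Basis.coord_apply, ← hx, ← hy, ← hz]
    linear_combination -(y / 2) * hb1 + z * hAv' + (z / 2) * hb2
  have hne : linForm (B.coord 1) * linForm (B.coord 1) -
      C 2 * linForm (B.coord 0) * linForm (B.coord 2) ≠ 0 := by
    intro h0
    have := congrArg (eval (B 1)) h0
    simp [eval_linForm] at this
  exact he0 (eq_zero_of_contr_eq_zero hN hω hco he ((mul_eq_zero.1 hkey).resolve_left hne))

include hN hω hco in
/-- The symmetries of a foliation of degree at least two form a Lie algebra of dimension at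
most two. -/
theorem finrank_symmetries_le : Module.finrank ℂ (symmetries ω) ≤ 2 := by
  by_contra hlt
  obtain ⟨h, hh, e, he, f, hf, he0, hnil, hhe, hef, hhf⟩ := exists_sl2_triple (symmetries ω)
    (by omega) fun A hA B hB hB0 hAB => exists_eq_smul_of_commute hN hω hco hA hB hB0 hAB
  have he3 : e ^ 3 = 0 := by
    have h1 := (LinearMap.isNilpotent_iff_charpoly (Matrix.toLinAlgEquiv' e)).1
      (hnil.map Matrix.toLinAlgEquiv')
    have h2 := LinearMap.aeval_self_charpoly (Matrix.toLinAlgEquiv' e)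
    rw [h1, map_pow, Polynomial.aeval_X, ← map_pow, Module.finrank_fin_fun] at h2
    exact (map_eq_zero_iff _ Matrix.toLinAlgEquiv'.injective).1 h2
  by_cases he2 : e * e = 0
  · exact not_sl2_triple_of_sq_eq_zero hN hω hco hh he hf he0 hhe hef hhf he2
  · exact not_sl2_triple_of_sq_ne_zero hN hω hco hh he hf he0 hhe hef hhf he2 (by
      rw [← he3]; noncomm_ring)

end Triples

/-! ### The Jacobian criterion for algebraic independence -/

lemma totalDegree_pderiv_le {ι : Type*} (i : ι) (p : MvPolynomial ι ℂ) :
    (pderiv i p).totalDegree ≤ p.totalDegree - 1 := by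
  refine Finset.sup_le fun m hm => ?_
  rw [mem_support_iff, coeff_pderiv] at hm
  have h1 := le_totalDegree (mem_support_iff.2 (left_ne_zero_of_mul hm))
  rw [Finsupp.sum_add_index' (fun _ => rfl) (fun _ _ _ => rfl), Finsupp.sum_single_index rfl] at h1
  omega

lemma eq_C_of_pderiv_eq_zero {ι : Type*} {p : MvPolynomial ι ℂ} (h : ∀ i, pderiv i p = 0) :
    p = C (coeff 0 p) := by
  classical
  ext m
  rw [coeff_C]
  split_ifs with hm
  · rw [hm]
  · obtain ⟨i, hi⟩ := Finsupp.ne_iff.1 (Ne.symm hm)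
    have h1 := coeff_pderiv (i := i) p (m - Finsupp.single i 1)
    rw [h i, coeff_zero, tsub_add_cancel_of_le
      (Finsupp.single_le_iff.2 (Nat.one_le_iff_ne_zero.2 hi))] at h1
    exact (mul_eq_zero.1 h1.symm).resolve_right (Nat.cast_add_one_ne_zero _)

/-- By the chain rule and the invertibility of the Jacobian, the partial derivatives of a relation
are again relations; induction on the degree reduces to constants. -/
lemma algebraicIndependent_of_jacobian {ι : Type*} [Fintype ι] [DecidableEq ι]
    (q : ι → MvPolynomial ι ℂ) (x : ι → ℂ)
    (hdet : (Matrix.of fun i j => eval x (pderiv j (q i))).det ≠ 0) : AlgebraicIndependent ℂ q := by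
  set J : Matrix ι ι (MvPolynomial ι ℂ) := Matrix.of fun i j => pderiv j (q i)
  have hJ : J.det ≠ 0 := by
    intro h0
    apply hdet
    have := congrArg (eval x) h0
    rwa [RingHom.map_det, map_zero] at this
  rw [algebraicIndependent_iff]
  have key : ∀ (n : ℕ) (P : MvPolynomial ι ℂ), P.totalDegree ≤ n → aeval q P = 0 → P = 0 := by
    intro n
    have hconst : ∀ P : MvPolynomial ι ℂ, (∀ i, pderiv i P = 0) → aeval q P = 0 → P = 0 := by
      intro P hP h0
      have hc := eq_C_of_pderiv_eq_zero hP
      rw [hc, aeval_C, algebraMap_eq] at h0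
      rw [hc, h0]
    have hder : ∀ P : MvPolynomial ι ℂ, aeval q P = 0 → ∀ i, aeval q (pderiv i P) = 0 := by
      intro P h0
      have h1 : Matrix.vecMul (fun i => aeval q (pderiv i P)) J = 0 := by
        funext j
        have := derivation_aeval (pderiv j) q P
        rw [h0, map_zero] at this
        simpa [Matrix.vecMul, dotProduct, J] using this.symm
      exact congrFun (Matrix.eq_zero_of_vecMul_eq_zero hJ h1)
    induction n with
    | zero =>
      intro P hP h0
      refine hconst P (fun i => ?_) h0
      rw [totalDegree_eq_zero_iff_eq_C.1 (Nat.le_zero.1 hP), pderiv_C]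
    | succ n ih =>
      intro P hP h0
      refine hconst P (fun i => ih _ ?_ (hder P h0 i)) h0
      have := totalDegree_pderiv_le i P
      omega
  exact fun P => key _ P le_rfl

/-! ### Transverse families of linear vector fields -/

lemma exists_linearIndependent_of_ne_zero {M : Type*} [AddCommGroup M] [Module ℂ M]
    [FiniteDimensional ℂ M] {v : M} (hv : v ≠ 0) (n : ℕ) (hn : n + 1 ≤ Module.finrank ℂ M) :
    ∃ b : Fin (n + 1) → M, LinearIndependent ℂ b ∧ b 0 = v := by
  induction n with
  | zero =>
    have : Subsingleton (Fin (0 + 1)) := inferInstanceAs (Subsingleton (Fin 1))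
    exact ⟨fun _ => v, LinearIndependent.of_subsingleton 0 hv, rfl⟩
  | succ n ih =>
    obtain ⟨b, hb, hb0⟩ := ih (by omega)
    obtain ⟨x, hx⟩ := exists_linearIndependent_snoc_of_lt_finrank hb (by omega)
    refine ⟨_, hx, ?_⟩
    rw [← hb0, ← Fin.castSucc_zero, Fin.snoc_castSucc]

lemma exists_dual_family {M : Type*} [AddCommGroup M] [Module ℂ M] {n : ℕ} {b : Fin n → M}
    (hb : LinearIndependent ℂ b) :
    ∃ l : Fin n → Module.Dual ℂ M, ∀ i j, l i (b j) = if i = j then 1 else 0 := by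
  obtain ⟨g, hg⟩ := LinearMap.exists_leftInverse_of_injective (Fintype.linearCombination ℂ b)
    (LinearMap.ker_eq_bot.2 hb.fintypeLinearCombination_injective)
  refine ⟨fun i => (LinearMap.proj i).comp g, fun i j => ?_⟩
  have := congrFun (LinearMap.congr_fun hg (Pi.single j 1)) i
  rw [LinearMap.comp_apply, Fintype.linearCombination_apply_single, one_smul] at this
  rw [LinearMap.comp_apply, LinearMap.proj_apply, this, LinearMap.id_apply, Pi.single_apply]

lemma exists_basis_extension {M κ ρ : Type} [AddCommGroup M] [Module ℂ M]
    [FiniteDimensional ℂ M] [Fintype κ] [Fintype ρ]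
    (hdim : Module.finrank ℂ M = Fintype.card κ + Fintype.card ρ) {v : ρ → M}
    (hv : LinearIndependent ℂ v) :
    ∃ b : Module.Basis (κ ⊕ ρ) ℂ M, ∀ j, b (Sum.inr j) = v j := by
  classical
  set B := Module.Basis.sumExtend hv with hB
  have := Module.Finite.finite_basis B
  have : Finite (Module.Basis.sumExtendIndex hv) :=
    Finite.of_injective (Sum.inr : _ → ρ ⊕ Module.Basis.sumExtendIndex hv) Sum.inr_injective
  have := Fintype.ofFinite (Module.Basis.sumExtendIndex hv)
  have hcard : Fintype.card (Module.Basis.sumExtendIndex hv) = Fintype.card κ := by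
    have := Module.finrank_eq_card_basis B
    rw [Fintype.card_sum] at this
    omega
  let E := Fintype.equivOfCardEq hcard
  refine ⟨B.reindex ((Equiv.sumCongr (Equiv.refl ρ) E).trans (Equiv.sumComm ρ κ)), fun j => ?_⟩
  rw [Module.Basis.reindex_apply]
  simp [hB, Module.Basis.sumExtend]
  rfl

lemma lieDeriv_smul (c : ℂ) (ω : OneForm) (A : Matrix (Fin 3) (Fin 3) ℂ) :
    lieDeriv (c • ω) A = c • lieDeriv ω A := by
  funext j
  simp [lieDeriv_apply, Finset.smul_sum]

section Transverse

variable {N : ℕ} {ω : OneForm} (hN : 2 ≤ N) (hω : ω ∈ eulerForms N)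
  (hco : ∀ d : MvPolynomial (Fin 3) ℂ, (∀ i, d ∣ ω i) → IsUnit d)
include hN hω hco

/-- The linear vector fields move a foliation of degree at least two in at least six directions. -/
lemma exists_transverse : ∃ (A : Fin 7 → Matrix (Fin 3) (Fin 3) ℂ)
    (l : Fin 7 → Module.Dual ℂ OneForm), A 0 = 1 ∧ (∀ i ≠ 0, l i ω = 0) ∧
      ∀ i j, l i (lieDeriv ω (A j)) = if i = j then 1 else 0 := by
  have h2 := finrank_symmetries_le hN hω hco
  have h3 := LinearMap.finrank_range_add_finrank_ker (lieDeriv ω)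
  have h9 : Module.finrank ℂ (Matrix (Fin 3) (Fin 3) ℂ) = 9 := by
    simp [Module.finrank_matrix]
  have hker : Module.finrank ℂ (LinearMap.ker (lieDeriv ω)) ≤ 2 := h2
  have hN0 : (N : ℂ) + 2 ≠ 0 := by exact_mod_cast (by omega : N + 2 ≠ 0)
  have hω0 : ω ≠ 0 := by
    rintro rfl
    exact not_isUnit_zero (hco 0 fun i => dvd_rfl)
  have h1 : lieDeriv ω 1 ≠ 0 := by
    rw [lieDeriv_one hω]
    exact smul_ne_zero hN0 hω0
  -- The image has dimension at least `9 - 2 = 7`. Its independent family starts with `L_1 ω = (N +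
  -- 2) ω`, so all dual functionals but the first kill `ω`.
  obtain ⟨b, hb, hb0⟩ := exists_linearIndependent_of_ne_zero
    (M := LinearMap.range (lieDeriv ω)) (v := ⟨lieDeriv ω 1, 1, rfl⟩)
    (fun h0 => h1 (congrArg Subtype.val h0)) 6 (by omega)
  have hb' : LinearIndependent ℂ fun i => (b i : OneForm) :=
    hb.map' (LinearMap.range (lieDeriv ω)).subtype (Submodule.ker_subtype _)
  obtain ⟨l, hl⟩ := exists_dual_family hb'
  choose A' hA' using fun i => (b i).2
  have hA : ∀ j, lieDeriv ω ((Function.update A' 0 1) j) = b j := by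
    intro j
    by_cases hj : j = 0
    · rw [hj, Function.update_self, hb0]
    · rw [Function.update_of_ne hj, hA']
  refine ⟨Function.update A' 0 1, l, Function.update_self .., fun i hi => ?_, fun i j => ?_⟩
  · have := hl i 0
    rw [hb0, if_neg hi] at this
    simp only [lieDeriv_one hω, map_smul, smul_eq_mul] at this
    exact (mul_eq_zero.1 this).resolve_left hN0
  · rw [hA, hl]

end Transverse

/-! ### The dimension of the isotropy group -/

lemma pullback_smul_matrix {N : ℕ} {ω : OneForm} (hω : ω ∈ eulerForms N) (c : ℂ)
    (g : Matrix (Fin 3) (Fin 3) ℂ) : pullback (c • g) ω = c ^ (N + 2) • pullback g ω := by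
  have : c • g = Matrix.scalar (Fin 3) c * g := by
    ext i j
    simp
  rw [this, pullback_mul, pullback_scalar c hω, map_smul]

lemma pullback_inv_pullback (g : GL (Fin 3) ℂ) (ω : OneForm) :
    pullback g.val (pullback (g⁻¹ : GL (Fin 3) ℂ).val ω) = ω := by
  rw [← pullback_mul, ← Units.val_mul, inv_mul_cancel, Units.val_one, pullback_one]

/-- Describes the cone over the isotropy group by equations on matrices: functionals killing `ω`
also kill its pull-backs by this cone. -/
lemma exists_pullback_eq_smul {N : ℕ} {ω : eulerForms N} (hω : ω ≠ 0)
    {w : Matrix (Fin 3) (Fin 3) ℂ} (hw : w ≠ 0)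
    (h : Projectivization.mk ℂ w hw ∈
      pglToMatrix '' (iso (Projectivization.mk ℂ ω hω) : Set PGL(3, ℂ))) :
    w.det ≠ 0 ∧ ∃ c : ℂ, c ≠ 0 ∧ pullback w ω.1 = c • ω.1 := by
  obtain ⟨γ, hγ, hγw⟩ := h
  obtain ⟨g, rfl⟩ := QuotientGroup.mk_surjective γ
  have hγw' : Projectivization.mk ℂ g.val (gl_val_ne_zero g) = Projectivization.mk ℂ w hw := hγw
  obtain ⟨c, rfl⟩ := (Projectivization.mk_eq_mk_iff' ..).1 hγw'.symm
  have hc : c ≠ 0 := by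
    rintro rfl
    exact hw (zero_smul _ _)
  have hγ' : Projectivization.mk ℂ (g • ω) ((smul_ne_zero_iff_ne g).2 hω) =
      Projectivization.mk ℂ ω hω := hγ
  obtain ⟨a, ha⟩ := (Projectivization.mk_eq_mk_iff' ..).1 hγ'.symm
  have ha' : a • pullback (g⁻¹ : GL (Fin 3) ℂ).val ω.1 = ω.1 := congrArg Subtype.val ha
  have ha2 : pullback g.val ω.1 = a • ω.1 := by
    have := congrArg (pullback g.val) ha'
    rw [map_smul, pullback_inv_pullback] at this
    exact this.symm
  have ha0 : a ≠ 0 := by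
    rintro rfl
    rw [zero_smul] at ha
    exact hω ha.symm
  refine ⟨?_, c ^ (N + 2) * a, mul_ne_zero (pow_ne_zero _ hc) ha0, ?_⟩
  · rw [Matrix.det_smul]
    exact mul_ne_zero (pow_ne_zero _ hc) (Matrix.GeneralLinearGroup.det g).ne_zero
  · rw [pullback_smul_matrix ω.2, ha2, smul_smul]

/-- The linear map sending the coordinates `x` to the matrix `∑ k, x k • A k`. -/
def combination {ι : Type*} [Fintype ι] (A : ι → Matrix (Fin 3) (Fin 3) ℂ) (x : ι → ℂ) :
    Matrix (Fin 3) (Fin 3) ℂ := ∑ k, x k • A k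

/-- The polynomial `orbitPoly l ω` on the matrices spanned by a family. -/
def familyPoly {ι : Type*} [Fintype ι] (A : ι → Matrix (Fin 3) (Fin 3) ℂ)
    (l : Module.Dual ℂ OneForm) (ω : OneForm) : MvPolynomial ι ℂ :=
  linSubst (fun k ij => A k ij.1 ij.2) (orbitPoly l ω)

section Family

variable {ι : Type*} [Fintype ι] (A : ι → Matrix (Fin 3) (Fin 3) ℂ)

lemma combination_apply (x : ι → ℂ) (i j : Fin 3) :
    combination A x i j = ∑ k, x k * A k i j := by
  simp [combination, Matrix.sum_apply]

lemma eval_familyPoly (l : Module.Dual ℂ OneForm) (ω : OneForm) (x : ι → ℂ) :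
    eval x (familyPoly A l ω) = l (pullback (combination A x) ω) := by
  rw [familyPoly, eval_linSubst, ← eval_orbitPoly]
  simp only [combination_apply]

lemma eval_pderiv_familyPoly (l : Module.Dual ℂ OneForm) (ω : OneForm) (x : ι → ℂ) (k : ι)
    {B : Matrix (Fin 3) (Fin 3) ℂ} (hB : A k = combination A x * B) :
    eval x (pderiv k (familyPoly A l ω)) =
      l (lieDeriv (pullback (combination A x) ω) B) := by
  rw [familyPoly, eval_pderiv_linSubst, ← sum_pderiv_orbitPoly, hB]
  simp only [combination_apply]

end Family

theorem groupDim_iso_le {N : ℕ} (hN : 2 ≤ N) {F : ℙ ℂ (eulerForms N)} (hF : F ∈ foliations N) :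
    groupDim (iso F) ≤ 2 := by
  obtain ⟨A, l, -, hl0, hl⟩ := exists_transverse hN F.rep.2 hF
  have hrep : Projectivization.mk ℂ F.rep F.rep_nonzero = F := F.mk_rep
  have hcone : ∀ {w : Matrix (Fin 3) (Fin 3) ℂ} (hw : w ≠ 0), Projectivization.mk ℂ w hw ∈
      pglToMatrix '' (iso F : Set PGL(3, ℂ)) →
      w.det ≠ 0 ∧ ∃ c : ℂ, c ≠ 0 ∧ pullback w F.rep.1 = c • F.rep.1 := by
    intro w hw h
    rw [← hrep] at h
    exact exists_pullback_eq_smul F.rep_nonzero hw h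
  -- Six of the nine matrix coordinates are eliminated, leaving a cone of dimension at most 3.
  refine zariskiDim_le_of_jacobian (κ := Fin 3) (ρ := Fin 6) (n := 2) (by simp) fun w hw hwS => ?_
  obtain ⟨hdet, c, hc, hwc⟩ := hcone hw hwS
  have hli : LinearIndependent ℂ fun j : Fin 6 => w * A j.succ := by
    rw [Fintype.linearIndependent_iff]
    intro g hg i
    have h1 : ∑ j, g j • A j.succ = 0 := by
      have h2 : w * ∑ j, g j • A j.succ = 0 := by
        rw [Finset.mul_sum, ← hg]
        simp only [mul_smul_comm]
      have := congrArg (w⁻¹ * ·) h2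
      simpa [← mul_assoc, Matrix.nonsing_inv_mul _ (isUnit_iff_ne_zero.2 hdet)] using this
    have h3 := congrArg (fun B => l i.succ (lieDeriv F.rep.1 B)) h1
    simpa [hl] using h3
  -- The directions `w * A j` are left translates by `w` of the transverse fields. Since `w^* ω = c
  -- ω`, the Jacobian along them is `c` times the identity.
  obtain ⟨b, hb⟩ := exists_basis_extension (κ := Fin 3) (by simp [Module.finrank_matrix]) hli
  have hcomb : ∀ v, combination b (b.repr v) = v := fun v => b.sum_repr v
  refine ⟨b, fun i => familyPoly b (l i.succ) F.rep.1, fun v hv hvS i => ?_, ?_⟩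
  · obtain ⟨-, d, -, hvd⟩ := hcone hv hvS
    rw [eval_familyPoly, hcomb, hvd, map_smul, hl0 _ (Fin.succ_ne_zero i), smul_zero]
  · have : (Matrix.of fun i j : Fin 6 => eval (b.repr w)
        (pderiv (Sum.inr j) (familyPoly b (l i.succ) F.rep.1))) = c • 1 := by
      ext i j
      rw [Matrix.of_apply, eval_pderiv_familyPoly b _ _ _ _ (B := A j.succ) (by rw [hb, hcomb]),
        hcomb, hwc, lieDeriv_smul, map_smul, hl, Matrix.smul_apply, Matrix.one_apply]
      simp
    rw [this, Matrix.det_smul, Matrix.det_one, mul_one]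
    exact pow_ne_zero _ hc

/-! ### Pieces of orbits parametrized by linear families of matrices -/

section Pieces

variable {N : ℕ} {ι : Type*} [Fintype ι] (A : ι → Matrix (Fin 3) (Fin 3) ℂ) (ω : eulerForms N)

/-- The pull-back of `ω` by a matrix of the family. -/
def familyMap (x : ι → ℂ) : eulerForms N := ⟨pullback (combination A x) ω.1, pullback_mem _ ω.2⟩

/-- The comorphism of `familyMap`. -/
def familyHom : MvPolynomial (Module.Dual ℂ (eulerForms N)) ℂ →ₐ[ℂ] MvPolynomial ι ℂ :=
  -- The choice of the extension of `l` to all one-forms is harmless, as pull-backs of `ω` stay in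
  -- `eulerForms N`.
  aeval fun l => familyPoly A (LinearMap.exists_extend l).choose ω.1

lemma eval_familyHom (x : ι → ℂ) (p : MvPolynomial (Module.Dual ℂ (eulerForms N)) ℂ) :
    eval x (familyHom A ω p) = evalAt (familyMap A ω x) p := by
  have h : (aeval x).comp (familyHom A ω) = evalAt (familyMap A ω x) := by
    apply MvPolynomial.algHom_ext
    intro l
    rw [AlgHom.comp_apply, familyHom, aeval_X, aeval_eq_eval, eval_familyPoly, evalAt_X]
    exact LinearMap.congr_fun (LinearMap.exists_extend l).choose_spec (familyMap A ω x)
  have := DFunLike.congr_fun h p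
  rwa [AlgHom.comp_apply, aeval_eq_eval] at this

lemma familyHom_X (l : Module.Dual ℂ OneForm) :
    familyHom A ω (X (l.comp (eulerForms N).subtype)) = familyPoly A l ω.1 := by
  refine MvPolynomial.funext fun x => ?_
  rw [eval_familyHom, evalAt_X, eval_familyPoly]
  rfl

/-- The determinant, as a polynomial on the family. -/
def familyDet : MvPolynomial ι ℂ := (Matrix.of fun i j => ∑ k, C (A k i j) * X k).det

lemma eval_familyDet (x : ι → ℂ) : eval x (familyDet A) = (combination A x).det := by
  rw [familyDet, RingHom.map_det]
  congr 1
  ext i j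
  simp [combination_apply, mul_comm]

/-- The classes of the pull-backs of `ω` by the invertible matrices of the family. -/
def familyOrbit : Set (ℙ ℂ (eulerForms N)) :=
  {y | ∃ x, (combination A x).det ≠ 0 ∧ ∃ h, y = Projectivization.mk ℂ (familyMap A ω x) h}

lemma familyMap_ne_zero {ω : eulerForms N} (hω : ω ≠ 0) {x : ι → ℂ}
    (hx : (combination A x).det ≠ 0) : familyMap A ω x ≠ 0 := by
  intro h0
  have h1 : pullback (combination A x) ω.1 = 0 := congrArg Subtype.val h0
  have h2 := congrArg (pullback (combination A x)⁻¹) h1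
  rw [← pullback_mul, Matrix.mul_nonsing_inv _ (isUnit_iff_ne_zero.2 hx), pullback_one,
    map_zero] at h2
  exact hω (Subtype.ext h2)

lemma familyMap_smul (c : ℂ) (x : ι → ℂ) :
    familyMap A ω (c • x) = c ^ (N + 2) • familyMap A ω x := by
  refine Subtype.ext ?_
  change pullback _ ω.1 = c ^ (N + 2) • pullback _ ω.1
  rw [← pullback_smul_matrix ω.2]
  simp [combination, Finset.smul_sum, smul_smul]

lemma mem_vanishingIdeal_familyOrbit {ω : eulerForms N} (hω : ω ≠ 0)
    (p : MvPolynomial (Module.Dual ℂ (eulerForms N)) ℂ) :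
    p ∈ vanishingIdeal (familyOrbit A ω) ↔
      ∀ x, (combination A x).det ≠ 0 → evalAt (familyMap A ω x) p = 0 := by
  rw [mem_vanishingIdeal]
  refine ⟨fun h x hx => h _ (familyMap_ne_zero A hω hx) ⟨x, hx, _, rfl⟩, ?_⟩
  rintro h v hv ⟨x, hx, hx0, hvx⟩
  obtain ⟨c, rfl⟩ := (Projectivization.mk_eq_mk_iff' ..).1 hvx
  have hc : c ≠ 0 := by
    rintro rfl
    exact hv (zero_smul _ _)
  -- The map is homogeneous of degree `N + 2`, so a root of `c` absorbs the scalar into the matrix.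
  obtain ⟨t, rfl⟩ := IsAlgClosed.exists_pow_nat_eq c (by omega : 0 < N + 2)
  rw [← familyMap_smul]
  refine h _ ?_
  have : combination A (t • x) = t • combination A x := by
    simp [combination, Finset.smul_sum, smul_smul]
  rw [this, Matrix.det_smul]
  exact mul_ne_zero (pow_ne_zero _ fun h0 => hc (by simp [h0])) hx

/-- A polynomial vanishing wherever the determinant is nonzero is zero, since its product with the
determinant vanishes everywhere. The ideal is thus the kernel of a map to a polynomial ring, and in
particular prime. -/
lemma vanishingIdeal_familyOrbit {ω : eulerForms N} (hω : ω ≠ 0)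
    (hA : ∃ x, (combination A x).det ≠ 0) :
    vanishingIdeal (familyOrbit A ω) = RingHom.ker (familyHom A ω) := by
  ext p
  rw [mem_vanishingIdeal_familyOrbit A hω, RingHom.mem_ker]
  constructor
  · intro h
    have hD : familyDet A ≠ 0 := by
      obtain ⟨x, hx⟩ := hA
      intro h0
      rw [← eval_familyDet, h0, map_zero] at hx
      exact hx rfl
    refine (mul_eq_zero.1 (MvPolynomial.funext fun x => ?_ :
      familyDet A * familyHom A ω p = 0)).resolve_left hD
    rw [map_mul, eval_familyDet, eval_familyHom, map_zero, mul_eq_zero, or_iff_not_imp_left]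
    exact h x
  · intro h x _
    rw [← eval_familyHom, h, map_zero]

end Pieces

lemma mem_orbit_mk {N : ℕ} {ω : eulerForms N} (hω : ω ≠ 0) {y : ℙ ℂ (eulerForms N)} :
    y ∈ orbit (Projectivization.mk ℂ ω hω) ↔
      ∃ g : Matrix (Fin 3) (Fin 3) ℂ, g.det ≠ 0 ∧
        ∃ h : (⟨pullback g ω.1, pullback_mem g ω.2⟩ : eulerForms N) ≠ 0,
          y = Projectivization.mk ℂ ⟨pullback g ω.1, pullback_mem g ω.2⟩ h := by
  constructor
  · rintro ⟨γ, rfl⟩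
    obtain ⟨g, rfl⟩ := QuotientGroup.mk_surjective γ
    exact ⟨(g⁻¹ : GL (Fin 3) ℂ).val, (Matrix.GeneralLinearGroup.det g⁻¹).ne_zero,
      (smul_ne_zero_iff_ne g).2 hω, rfl⟩
  · rintro ⟨g, hg, h, rfl⟩
    refine ⟨Matrix.ProjGenLinGroup.mk (Matrix.GeneralLinearGroup.mkOfDetNeZero g hg)⁻¹, ?_⟩
    change Projectivization.mk ℂ ((Matrix.GeneralLinearGroup.mkOfDetNeZero g hg)⁻¹ • ω) _ = _
    congr 1

/-! ### The lower bound for the dimension of the orbits -/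

lemma familyOrbit_subset_orbit {N : ℕ} {ι : Type*} [Fintype ι]
    (A : ι → Matrix (Fin 3) (Fin 3) ℂ) {ω : eulerForms N} (hω : ω ≠ 0) :
    familyOrbit A ω ⊆ orbit (Projectivization.mk ℂ ω hω) := by
  rintro y ⟨x, hx, h, rfl⟩
  exact (mem_orbit_mk hω).2 ⟨_, hx, h, rfl⟩

lemma combination_extend {ι κ : Type*} [Fintype ι] [Fintype κ]
    (B : κ → Matrix (Fin 3) (Fin 3) ℂ) {j : ι → κ} (hj : Function.Injective j) (x : ι → ℂ) :
    combination B (Function.extend j x 0) = combination (B ∘ j) x := by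
  refine (Fintype.sum_of_injective j hj _ _ (fun k hk => ?_) fun k => ?_).symm
  · rw [Function.extend_apply' _ _ _ fun ⟨a, ha⟩ => hk ⟨a, ha⟩, Pi.zero_apply, zero_smul]
  · rw [hj.extend_apply]
    rfl

lemma combination_single {ι : Type*} [Fintype ι] [DecidableEq ι]
    (A : ι → Matrix (Fin 3) (Fin 3) ℂ) (k : ι) : combination A (Pi.single k 1) = A k := by
  rw [combination, Finset.sum_eq_single k]
  · rw [Pi.single_eq_same, one_smul]
  · intro j _ hj
    rw [Pi.single_eq_of_ne hj, zero_smul]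
  · simp

lemma familyOrbit_comp_subset {N : ℕ} {ι κ : Type*} [Fintype ι] [Fintype κ]
    (B : κ → Matrix (Fin 3) (Fin 3) ℂ) {j : ι → κ} (hj : Function.Injective j)
    (ω : eulerForms N) : familyOrbit (B ∘ j) ω ⊆ familyOrbit B ω := by
  rintro y ⟨x, hx, h, rfl⟩
  have hmap : familyMap B ω (Function.extend j x 0) = familyMap (B ∘ j) ω x :=
    Subtype.ext (congrArg (fun M => pullback M ω.1) (combination_extend B hj x))
  have hne : familyMap B ω (Function.extend j x 0) ≠ 0 := by
    rw [hmap]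
    exact h
  refine ⟨Function.extend j x 0, by rwa [combination_extend B hj], hne,
    (Projectivization.mk_eq_mk_iff' ..).2 ⟨1, ?_⟩⟩
  rw [one_smul, hmap]

lemma familyHom_rename {N : ℕ} {ι κ : Type*} [Fintype ι] (A : ι → Matrix (Fin 3) (Fin 3) ℂ)
    (ω : eulerForms N) (l : κ → Module.Dual ℂ OneForm) (P : MvPolynomial κ ℂ) :
    familyHom A ω (rename (fun i => (l i).comp (eulerForms N).subtype) P) =
      aeval (fun i => familyPoly A (l i) ω.1) P := by
  rw [← AlgHom.comp_apply]
  congr 1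
  apply MvPolynomial.algHom_ext
  intro i
  rw [AlgHom.comp_apply, rename_X, familyHom_X, aeval_X]

/-- If the ideals agreed, the functions `familyPoly` for the larger family would satisfy the same
relations as their restrictions to the smaller one. The restrictions are dependent, being more
numerous than the variables; on the larger family they are independent, since their Jacobian at the
identity matrix is the identity. -/
lemma vanishingIdeal_familyOrbit_lt {N : ℕ} {ι κ : Type} [Fintype ι] [Fintype κ] [DecidableEq κ]
    {B : κ → Matrix (Fin 3) (Fin 3) ℂ} {j : ι → κ} (hj : Function.Injective j)
    (hcard : Fintype.card ι < Fintype.card κ) {ω : eulerForms N} (hω : ω ≠ 0) {k : ι}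
    (hk : B (j k) = 1) {l : κ → Module.Dual ℂ OneForm}
    (hl : ∀ i m, l i (lieDeriv ω.1 (B m)) = if i = m then 1 else 0) :
    vanishingIdeal (familyOrbit B ω) < vanishingIdeal (familyOrbit (B ∘ j) ω) := by
  classical
  refine lt_of_le_of_ne (vanishingIdeal_anti (familyOrbit_comp_subset B hj ω)) fun heq => ?_
  have hk' : combination B (Pi.single (j k) 1) = 1 := by rw [combination_single, hk]
  rw [vanishingIdeal_familyOrbit B hω ⟨Pi.single (j k) 1, by simp [hk']⟩,
    vanishingIdeal_familyOrbit (B ∘ j) hω ⟨Pi.single k 1, by simp [combination_single, hk]⟩] at heq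
  have hdep : ¬ AlgebraicIndependent ℂ fun i => familyPoly (B ∘ j) (l i) ω.1 := by
    intro h
    have := h.lift_cardinalMk_le_trdeg
    rw [MvPolynomial.trdeg_of_isDomain] at this
    simp only [Cardinal.mk_fintype, Cardinal.lift_natCast, Nat.cast_le] at this
    omega
  apply hdep
  rw [algebraicIndependent_iff]
  intro P hP
  have hind := algebraicIndependent_of_jacobian (fun i => familyPoly B (l i) ω.1)
    (Pi.single (j k) 1) (by
      have : (Matrix.of fun i m => eval (Pi.single (j k) 1)
          (pderiv m (familyPoly B (l i) ω.1))) = 1 := by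
        ext i m
        rw [Matrix.of_apply, eval_pderiv_familyPoly B _ _ _ _ (B := B m) (by rw [hk', one_mul]),
          hk', pullback_one, hl, Matrix.one_apply]
      rw [this, Matrix.det_one]
      exact one_ne_zero)
  refine algebraicIndependent_iff.1 hind P ?_
  rw [← familyHom_rename] at hP ⊢
  rwa [← RingHom.mem_ker, heq]

theorem six_le_zariskiDim_orbit {N : ℕ} (hN : 2 ≤ N) {F : ℙ ℂ (eulerForms N)}
    (hF : F ∈ foliations N) : 6 ≤ zariskiDim (orbit F) := by
  obtain ⟨A, l, hA0, -, hl⟩ := exists_transverse hN F.rep.2 hF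
  have hω := F.rep_nonzero
  -- Nested families spanned by `A 0, …, A k`. Each contains `A 0 = 1`, so it has invertible
  -- members; the family for `k = 0` gives the point `F` itself.
  let B : (k : Fin 7) → {i : Fin 7 // i ≤ k} → Matrix (Fin 3) (Fin 3) ℂ := fun k i => A i.1
  have hdet : ∀ k, ∃ x, (combination (B k) x).det ≠ 0 := fun k =>
    ⟨Pi.single ⟨0, Fin.zero_le k⟩ 1, by simp [combination_single, B, hA0]⟩
  refine le_zariskiDim (n := 6) (fun k => familyOrbit (B k) F.rep) (fun k => ?_) (fun k => ?_)
    (fun k => ?_) ?_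
  · have := familyOrbit_subset_orbit (B k) hω
    rwa [F.mk_rep] at this
  · obtain ⟨x, hx⟩ := hdet k
    exact ⟨_, x, hx, familyMap_ne_zero (B k) hω hx, rfl⟩
  · rw [vanishingIdeal_familyOrbit (B k) hω (hdet k)]
    exact RingHom.ker_isPrime _
  · rw [Fin.strictAnti_iff_succ_lt]
    intro k
    let j : {i : Fin 7 // i ≤ k.castSucc} → {i : Fin 7 // i ≤ k.succ} :=
      fun i => ⟨i.1, i.2.trans k.castSucc_lt_succ.le⟩
    have hj : Function.Injective j := fun a b hab => Subtype.ext (congrArg (fun i => i.1) hab)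
    have hcard : Fintype.card {i : Fin 7 // i ≤ k.castSucc} <
        Fintype.card {i : Fin 7 // i ≤ k.succ} :=
      Fintype.card_lt_of_injective_of_notMem j hj (b := ⟨k.succ, le_rfl⟩) fun ⟨a, ha⟩ =>
        absurd (a.2.trans_lt k.castSucc_lt_succ) (not_lt.2 (congrArg Subtype.val ha).ge)
    have hk : B k.succ (j ⟨0, Fin.zero_le _⟩) = 1 := hA0
    have hl' : ∀ i m : {i : Fin 7 // i ≤ k.succ},
        l i.1 (lieDeriv F.rep.1 (B k.succ m)) = if i = m then 1 else 0 := by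
      intro i m
      rw [hl]
      simp [Subtype.ext_iff]
    exact vanishingIdeal_familyOrbit_lt hj hcard hω hk hl'

/-! ### The foliation `F₁` -/

lemma isUnit_of_dvd_formOne {d : MvPolynomial (Fin 3) ℂ} (h : ∀ i, d ∣ formOne.1 i) : IsUnit d := by
  have h0 : d ∣ X 0 ^ 2 * X 2 - X 1 ^ 3 := h 0
  have h2 : d ∣ X 0 ^ 3 := (dvd_neg.1 (h 2 : d ∣ -X 0 ^ 3))
  have hX : Irreducible (X 0 : MvPolynomial (Fin 3) ℂ) := X_prime.irreducible
  have hnd : ¬ (X 0 : MvPolynomial (Fin 3) ℂ) ∣ X 0 ^ 2 * X 2 - X 1 ^ 3 := by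
    rintro ⟨q, hq⟩
    have := congrArg (eval ![0, 1, 0]) hq
    simp at this
  exact (hX.isRelPrime_iff_not_dvd.2 hnd).pow_left h2 h0

theorem foliationOne_mem : foliationOne ∈ foliations 2 := by
  intro d hd
  obtain ⟨a, ha⟩ := Projectivization.exists_smul_eq_mk_rep ℂ formOne formOne_ne_zero
  refine isUnit_of_dvd_formOne fun i => ?_
  have h1 : d ∣ ((a : ℂ) • formOne.1) i := by
    have h2 : (a : ℂ) • formOne.1 = (Projectivization.mk ℂ formOne formOne_ne_zero).rep.1 :=
      congrArg Subtype.val ha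
    rw [h2]
    exact hd i
  rw [Pi.smul_apply, MvPolynomial.smul_eq_C_mul] at h1
  exact ((a.isUnit.map C).dvd_mul_left).1 h1

/-- The form is `X² (Z dX - X dZ) + Y² (X dY - Y dX)`. Adding a multiple of `X` to `Z` does not
change `Z dX - X dZ`, and the scalings multiply the two summands by `s³ r` and `s t³`. -/
lemma pullback_formOne {s t r : ℂ} (c : ℂ) (hsr : s ^ 3 * r = 1) (hst : s * t ^ 3 = 1) :
    pullback !![s, 0, 0; 0, t, 0; c, 0, r] formOne.1 = formOne.1 := by
  have hsr' : (C s : MvPolynomial (Fin 3) ℂ) ^ 3 * C r = 1 := by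
    rw [← C_pow, ← C_mul, hsr, C_1]
  have hst' : (C s : MvPolynomial (Fin 3) ℂ) * C t ^ 3 = 1 := by
    rw [← C_pow, ← C_mul, hst, C_1]
  have e0 : formOne.1 0 = X 0 ^ 2 * X 2 - X 1 ^ 3 := rfl
  have e1 : formOne.1 1 = X 0 * X 1 ^ 2 := rfl
  have e2 : formOne.1 2 = -X 0 ^ 3 := rfl
  funext j
  rw [pullback_apply, Fin.sum_univ_three, e0, e1, e2]
  simp only [map_sub, map_mul, map_pow, map_neg, substLin_X, Fin.sum_univ_three]
  fin_cases j
  · simp [e0]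
    linear_combination X 0 ^ 2 * X 2 * hsr' - X 1 ^ 3 * hst'
  · simp [e1]
    linear_combination X 0 * X 1 ^ 2 * hst'
  · simp [e2]
    linear_combination X 0 ^ 3 * hsr'

/-- The matrices whose first column is proportional to `(1, 1, 0)`. -/
def sliceFamily : Fin 7 → Matrix (Fin 3) (Fin 3) ℂ :=
  ![!![1, 0, 0; 1, 0, 0; 0, 0, 0], !![0, 1, 0; 0, 0, 0; 0, 0, 0], !![0, 0, 1; 0, 0, 0; 0, 0, 0],
    !![0, 0, 0; 0, 1, 0; 0, 0, 0], !![0, 0, 0; 0, 0, 1; 0, 0, 0], !![0, 0, 0; 0, 0, 0; 0, 1, 0],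
    !![0, 0, 0; 0, 0, 0; 0, 0, 1]]

lemma combination_sliceFamily (x : Fin 7 → ℂ) :
    combination sliceFamily x = !![x 0, x 1, x 2; x 0, x 3, x 4; 0, x 5, x 6] := by
  ext i j
  rw [combination_apply, Fin.sum_univ_seven]
  fin_cases i <;> fin_cases j <;> simp [sliceFamily]

lemma exists_pullback_eq_slice {g : Matrix (Fin 3) (Fin 3) ℂ} (h0 : g 0 0 ≠ 0) (h1 : g 1 0 ≠ 0) :
    ∃ x, pullback g formOne.1 = pullback (combination sliceFamily x) formOne.1 := by
  -- Take the symmetry with `s = t⁻³` and `r = t⁹`. The first two entries of the first column become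
  -- equal exactly when `t⁴ = g 0 0 / g 1 0`, and `c` is chosen to kill the third.
  obtain ⟨t, ht⟩ := IsAlgClosed.exists_pow_nat_eq (g 0 0 / g 1 0) (by norm_num : 0 < 4)
  have ht0 : t ≠ 0 := by
    rintro rfl
    rw [zero_pow (by norm_num)] at ht
    exact div_ne_zero h0 h1 ht.symm
  obtain ⟨c, hc⟩ : ∃ c, c = -(t ^ 9 * g 2 0) / g 0 0 := ⟨_, rfl⟩
  have hsr : (t ^ 3)⁻¹ ^ 3 * t ^ 9 = 1 := by field_simp
  have hst : (t ^ 3)⁻¹ * t ^ 3 = 1 := by field_simp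
  have e1 : t * g 1 0 = (t ^ 3)⁻¹ * g 0 0 := by
    rw [eq_div_iff h1] at ht
    rw [← ht]
    field_simp
  have e2 : c * g 0 0 + t ^ 9 * g 2 0 = 0 := by
    rw [hc, div_mul_cancel₀ _ h0]
    ring
  have hM : !![(t ^ 3)⁻¹, 0, 0; 0, t, 0; c, 0, t ^ 9] * g = combination sliceFamily
      ![(t ^ 3)⁻¹ * g 0 0, (t ^ 3)⁻¹ * g 0 1, (t ^ 3)⁻¹ * g 0 2, t * g 1 1, t * g 1 2,
        c * g 0 1 + t ^ 9 * g 2 1, c * g 0 2 + t ^ 9 * g 2 2] := by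
    rw [combination_sliceFamily]
    ext i j
    rw [Matrix.mul_apply, Fin.sum_univ_three]
    fin_cases i <;> fin_cases j <;> simp [e1, e2]
  exact ⟨_, by rw [← hM, pullback_mul, pullback_formOne c hsr hst]⟩

lemma zariskiDim_orbit_foliationOne_le : zariskiDim (orbit foliationOne) ≤ 6 := by
  refine zariskiDim_le_of_algHom (n := 6) (familyHom sliceFamily formOne) ?_
  let E : Fin 3 × Fin 3 → Matrix (Fin 3) (Fin 3) ℂ := fun ij => Matrix.single ij.1 ij.2 1
  have hE : ∀ x, combination E x = Matrix.of fun i j => x (i, j) := by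
    intro x
    ext i j
    rw [combination_apply, Fintype.sum_prod_type]
    simp [E, Matrix.single_apply, Finset.sum_ite_eq', ite_and]
  have hEone : ∃ x, (combination E x).det ≠ 0 :=
    ⟨fun ij => (1 : Matrix (Fin 3) (Fin 3) ℂ) ij.1 ij.2, by
      rw [hE]
      exact (Matrix.det_one (n := Fin 3) (R := ℂ)).trans_ne one_ne_zero⟩
  have hsub : orbit foliationOne ⊆ familyOrbit E formOne := by
    intro y hy
    obtain ⟨g, hg, h, rfl⟩ := (mem_orbit_mk formOne_ne_zero).1 hy
    have hgE : combination E (fun ij => g ij.1 ij.2) = g := hE _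
    have hmap : familyMap E formOne (fun ij => g ij.1 ij.2) =
        ⟨pullback g formOne.1, pullback_mem g formOne.2⟩ :=
      Subtype.ext (congrArg (fun M => pullback M formOne.1) hgE)
    refine ⟨fun ij => g ij.1 ij.2, by rwa [hgE], by rwa [hmap],
      (Projectivization.mk_eq_mk_iff' ..).2 ⟨1, ?_⟩⟩
    rw [one_smul, hmap]
  refine le_trans ?_ (vanishingIdeal_anti hsub)
  rw [vanishingIdeal_familyOrbit E formOne_ne_zero hEone]
  intro p hp
  rw [RingHom.mem_ker] at hp ⊢
  -- Only matrices with both entries nonzero can be moved into the slice; multiplying by these two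
  -- coordinates handles the others.
  have hprod : X (0, 0) * X (1, 0) * familyHom E formOne p = 0 := by
    refine MvPolynomial.funext fun x => ?_
    rw [map_mul, map_mul, eval_X, eval_X, map_zero, mul_eq_zero, or_iff_not_imp_left]
    intro hx
    rw [mul_eq_zero, not_or] at hx
    obtain ⟨x', hx'⟩ := exists_pullback_eq_slice (g := combination E x) (by rw [hE]; exact hx.1)
      (by rw [hE]; exact hx.2)
    have hmap : familyMap E formOne x = familyMap sliceFamily formOne x' := Subtype.ext hx'
    rw [eval_familyHom, hmap, ← eval_familyHom, hp, map_zero]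
  exact (mul_eq_zero.1 hprod).resolve_left (mul_ne_zero (X_ne_zero _) (X_ne_zero _))

end PlaneFoliation

end

theorem mainTheorem5 :
    (∀ N : ℕ, 2 ≤ N → ∀ F ∈ PlaneFoliation.foliations N,
      6 ≤ PlaneFoliation.zariskiDim (PlaneFoliation.orbit F) ∧
      PlaneFoliation.groupDim (PlaneFoliation.iso F) ≤ 2) ∧
    (PlaneFoliation.foliationOne ∈ PlaneFoliation.foliations 2 ∧
      PlaneFoliation.zariskiDim (PlaneFoliation.orbit PlaneFoliation.foliationOne) = 6 ∧
      ∀ F ∈ PlaneFoliation.foliations 2,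
        PlaneFoliation.zariskiDim (PlaneFoliation.orbit PlaneFoliation.foliationOne) ≤
          PlaneFoliation.zariskiDim (PlaneFoliation.orbit F)) := by
  open PlaneFoliation in
  exact ⟨fun N hN F hF => ⟨six_le_zariskiDim_orbit hN hF, groupDim_iso_le hN hF⟩,
    foliationOne_mem,
    le_antisymm zariskiDim_orbit_foliationOne_le
      (six_le_zariskiDim_orbit le_rfl foliationOne_mem),
    fun F hF => zariskiDim_orbit_foliationOne_le.trans (six_le_zariskiDim_orbit le_rfl hF)⟩
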